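/- **Proposition 3.2.** Let $\mathcal A$ and $\mathcal B$ be (not necessarily unital) complex C$^*$-algebras. Suppose that $\mathcal A$ is a separable quasidiagonal C$^*$-algebra, i.e. $\mathcal A$ is separable and there are a faithful $*$-representation $\pi:\mathcal A\to B(\mathcal H)$ on a Hilbert space $\mathcal H$ and an increasing sequence $\{p_i\}_{i=1}^\infty$ of finite-rank projections on $\mathcal H$, tending strongly to the identity, such that $\|\pi(x)p_i-p_i\pi(x)\|\to 0$ as $i\to\infty$ for every $x\in\mathcal A$. Suppose that $\mathcal B$ is an MF algebra, where a C$^*$-algebra $\mathcal C$ is called an MF algebra if it is separable and there is an embedding (an injective $*$-homomorphism) of $\mathcal C$ into $\prod_k \mathcal M_{n_k}(\mathbb C)/\sum_k \mathcal M_{n_k}(\mathbb C)$ for some sequence of positive integers $\{n_k\}_{k=1}^\infty$; here $\mathcal M_n(\mathbb C)$ is the C$^*$-algebra of $n\times n$ complex matrices, $\prod_k \mathcal M_{n_k}(\mathbb C)$ is the C$^*$-algebra of norm-bounded sequences with the supremum norm, and $\sum_k \mathcal M_{n_k}(\mathbb C)$ is its ideal of sequences whose norms tend to $0$. Then the minimal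 (spatial) tensor product $\mathcal A\otimes_{\min}\mathcal B$ is an MF algebra. Here $\mathcal A\otimes_{\min}\mathcal B$ is the completion of the algebraic tensor product $\mathcal A\odot\mathcal B$ in the norm $$\Big\|\sum_j a_j\otimes b_j\Big\|_{\min}=\sup_{\sigma,\rho}\Big\|\sum_j \sigma(a_j)\otimes\rho(b_j)\Big\|_{B(\mathcal H_\sigma\otimes\mathcal H_\rho)},$$ the supremum being over all $*$-representations $\sigma$ of $\mathcal A$ and $\rho$ of $\mathcal B$ on Hilbert spaces $\mathcal H_\sigma$, $\mathcal H_\rho$, with $\mathcal H_\sigma\otimes\mathcal H_\rho$ the Hilbert space tensor product (the supremum is attained at any pair of faithful representations). -/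

import Mathlib

open Filter Topology
open scoped ENNReal TensorProduct Matrix.Norms.L2Operator

universe u v

noncomputable section

/-! ### The C*-algebras `∏ₖ Aₖ` and `∏ₖ Aₖ / ∑ₖ Aₖ`

The C*-algebra `∏ₖ Aₖ` of bounded sequences with the supremum norm is `lp A ∞`. -/

section ProdModSum

variable (A : ℕ → Type u) [∀ k, NonUnitalCStarAlgebra (A k)]

/-- The ideal `∑ₖ Aₖ` of `∏ₖ Aₖ`: the sequences whose norms tend to `0`. -/
def sumIdeal : Submodule ℂ (lp A ∞) where
  carrier := {x | Tendsto (fun k => ‖x k‖) atTop (𝓝 0)}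
  zero_mem' := by simp
  add_mem' {x y} hx hy :=
    squeeze_zero (fun k => norm_nonneg _) (fun k => norm_add_le (x k) (y k))
      (by simpa using Tendsto.add hx hy)
  smul_mem' c x hx := by
    have h : Tendsto (fun k => ‖c‖ * ‖x k‖) atTop (𝓝 0) := by
      simpa using Tendsto.const_mul ‖c‖ hx
    simpa [norm_smul] using h

variable {A}

lemma mem_sumIdeal {x : lp A ∞} :
    x ∈ sumIdeal A ↔ Tendsto (fun k => ‖x k‖) atTop (𝓝 0) := Iff.rfl

lemma sumIdeal_mul_left (y : lp A ∞) {x : lp A ∞} (hx : x ∈ sumIdeal A) :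
    y * x ∈ sumIdeal A := by
  rw [mem_sumIdeal] at *
  refine squeeze_zero (fun k => norm_nonneg _) (fun k => ?_)
    (by simpa using Tendsto.const_mul ‖y‖ hx)
  rw [lp.infty_coeFn_mul, Pi.mul_apply]
  exact (norm_mul_le _ _).trans
    (mul_le_mul_of_nonneg_right (lp.norm_apply_le_norm ENNReal.top_ne_zero y k) (norm_nonneg _))

lemma sumIdeal_mul_right (y : lp A ∞) {x : lp A ∞} (hx : x ∈ sumIdeal A) :
    x * y ∈ sumIdeal A := by
  rw [mem_sumIdeal] at *
  refine squeeze_zero (fun k => norm_nonneg _) (fun k => ?_)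
    (by simpa using Tendsto.mul_const ‖y‖ hx)
  rw [lp.infty_coeFn_mul, Pi.mul_apply]
  exact (norm_mul_le _ _).trans
    (mul_le_mul_of_nonneg_left (lp.norm_apply_le_norm ENNReal.top_ne_zero y k) (norm_nonneg _))

lemma sumIdeal_star {x : lp A ∞} (hx : x ∈ sumIdeal A) : star x ∈ sumIdeal A := by
  rw [mem_sumIdeal] at *
  simpa [lp.star_apply] using hx

instance isClosed_sumIdeal : IsClosed (sumIdeal A : Set (lp A ∞)) := by
  refine isClosed_of_closure_subset fun x hx => ?_
  rw [SetLike.mem_coe, mem_sumIdeal, Metric.tendsto_atTop]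
  intro ε hε
  obtain ⟨y, hy, hxy⟩ := Metric.mem_closure_iff.1 hx (ε / 2) (by positivity)
  obtain ⟨N, hN⟩ := Metric.tendsto_atTop.1 (mem_sumIdeal.1 hy) (ε / 2) (by positivity)
  refine ⟨N, fun k hk => ?_⟩
  have h1 := hN k hk
  have h2 : ‖(x - y) k‖ ≤ ‖x - y‖ := lp.norm_apply_le_norm ENNReal.top_ne_zero _ k
  rw [lp.coeFn_sub, Pi.sub_apply] at h2
  rw [dist_eq_norm] at hxy
  have h3 := norm_le_norm_add_norm_sub' (x k) (y k)
  simp only [dist_zero_right, norm_norm] at h1 ⊢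
  linarith

variable (A) in
/-- The quotient `∏ₖ Aₖ / ∑ₖ Aₖ`. Its linear structure and its quotient norm are the ones of the
quotient by the closed subspace `∑ₖ Aₖ`. -/
def ProdModSum : Type u := lp A ∞ ⧸ sumIdeal A

namespace ProdModSum

instance : NormedAddCommGroup (ProdModSum A) :=
  inferInstanceAs (NormedAddCommGroup (lp A ∞ ⧸ sumIdeal A))

instance : NormedSpace ℂ (ProdModSum A) :=
  inferInstanceAs (NormedSpace ℂ (lp A ∞ ⧸ sumIdeal A))

instance : CompleteSpace (ProdModSum A) :=
  inferInstanceAs (CompleteSpace (lp A ∞ ⧸ sumIdeal A))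

variable (A) in
/-- The canonical quotient map `∏ₖ Aₖ → ∏ₖ Aₖ / ∑ₖ Aₖ`, `⟨xₖ⟩ ↦ [⟨xₖ⟩]`. -/
def mk : lp A ∞ →ₗ[ℂ] ProdModSum A := (sumIdeal A).mkQ

lemma mk_surjective : Function.Surjective (mk A) := (sumIdeal A).mkQ_surjective

lemma mk_eq_mk {x y : lp A ∞} : mk A x = mk A y ↔ x - y ∈ sumIdeal A :=
  Submodule.Quotient.eq (sumIdeal A)

/-- Multiplication of classes: `[x] [y] = [x y]`. -/
instance : Mul (ProdModSum A) where
  mul := Quotient.map₂ (· * ·) fun x x' hx y y' hy => by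
    have hx' : x - x' ∈ sumIdeal A := (sumIdeal A).quotientRel_def.1 hx
    have hy' : y - y' ∈ sumIdeal A := (sumIdeal A).quotientRel_def.1 hy
    refine (sumIdeal A).quotientRel_def.2 ?_
    have h := (sumIdeal A).add_mem (sumIdeal_mul_right y hx') (sumIdeal_mul_left x' hy')
    have e : x * y - x' * y' = (x - x') * y + x' * (y - y') := by noncomm_ring
    rwa [e]

/-- The involution on classes: `[x]* = [x*]`. -/
instance : Star (ProdModSum A) where
  star := Quotient.map star fun x x' hx => by
    have hx' : x - x' ∈ sumIdeal A := (sumIdeal A).quotientRel_def.1 hx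
    refine (sumIdeal A).quotientRel_def.2 ?_
    rw [← star_sub]
    exact sumIdeal_star hx'

lemma mk_mul (x y : lp A ∞) : mk A (x * y) = mk A x * mk A y := rfl

lemma mk_star (x : lp A ∞) : mk A (star x) = star (mk A x) := rfl

/-- The quotient norm of `[x]` is at most every eventual bound of `‖xₖ‖`. -/
lemma norm_mk_le_of_eventually {x : lp A ∞} {r : ℝ} (hr : 0 ≤ r)
    (h : ∀ᶠ k in atTop, ‖x k‖ ≤ r) : ‖mk A x‖ ≤ r := by
  obtain ⟨N, hN⟩ := eventually_atTop.1 h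
  let f : ∀ k, A k := fun k => if k < N then 0 else x k
  have hf : ∀ k, ‖f k‖ ≤ r := fun k => by
    by_cases hk : k < N
    · simpa [f, hk] using hr
    · simpa [f, hk] using hN k (not_lt.1 hk)
  let y : lp A ∞ := ⟨f, memℓp_infty ⟨r, by rintro _ ⟨k, rfl⟩; exact hf k⟩⟩
  have hxy : mk A x = mk A y := by
    rw [mk_eq_mk, mem_sumIdeal]
    refine tendsto_const_nhds.congr' ?_
    filter_upwards [eventually_ge_atTop N] with k hk
    have h0 : f k = x k := by simp [f, not_lt.2 hk]
    have h1 : (x - y) k = 0 := by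
      rw [lp.coeFn_sub, Pi.sub_apply]
      exact sub_eq_zero.2 h0.symm
    rw [h1, norm_zero]
  rw [hxy]
  exact (Submodule.Quotient.norm_mk_le (S := sumIdeal A) y).trans
    (lp.norm_le_of_forall_le hr hf)

/-- Eventually `‖xₖ‖` is at most the quotient norm of `[x]` up to `ε`. -/
lemma eventually_norm_le (x : lp A ∞) {ε : ℝ} (hε : 0 < ε) :
    ∀ᶠ k in atTop, ‖x k‖ ≤ ‖mk A x‖ + ε := by
  obtain ⟨m, hm, hm'⟩ :=
    Submodule.Quotient.norm_mk_lt (S := sumIdeal A) (mk A x) (half_pos hε)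
  have hm' : ‖m‖ < ‖mk A x‖ + ε / 2 := hm'
  have hmx : x - m ∈ sumIdeal A := mk_eq_mk.1 hm.symm
  filter_upwards [(mem_sumIdeal.1 hmx).eventually (gt_mem_nhds (half_pos hε))] with k hk
  have h1 : ‖m k‖ ≤ ‖m‖ := lp.norm_apply_le_norm ENNReal.top_ne_zero m k
  have h2 := norm_le_norm_add_norm_sub' (x k) (m k)
  rw [lp.coeFn_sub, Pi.sub_apply] at hk
  linarith

lemma ind {p : ProdModSum A → Prop} (h : ∀ x, p (mk A x)) (z : ProdModSum A) : p z := by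
  obtain ⟨x, rfl⟩ := mk_surjective z
  exact h x

instance : NonUnitalNormedRing (ProdModSum A) where
  __ := (inferInstance : NormedAddCommGroup (ProdModSum A))
  left_distrib := ind fun x => ind fun y => ind fun z => congrArg (mk A) (mul_add x y z)
  right_distrib := ind fun x => ind fun y => ind fun z => congrArg (mk A) (add_mul x y z)
  zero_mul := ind fun x => congrArg (mk A) (zero_mul x)
  mul_zero := ind fun x => congrArg (mk A) (mul_zero x)
  mul_assoc := ind fun x => ind fun y => ind fun z => congrArg (mk A) (mul_assoc x y z)
  norm_mul_le := ind fun x => ind fun y => by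
    have key : ∀ ε : ℝ, 0 < ε →
        ‖mk A (x * y)‖ ≤ (‖mk A x‖ + ε) * (‖mk A y‖ + ε) := fun ε hε => by
      refine norm_mk_le_of_eventually (by positivity) ?_
      filter_upwards [eventually_norm_le x hε, eventually_norm_le y hε] with k h1 h2
      rw [lp.infty_coeFn_mul, Pi.mul_apply]
      exact (norm_mul_le _ _).trans (mul_le_mul h1 h2 (norm_nonneg _) (by positivity))
    have hlim : Tendsto (fun ε : ℝ => (‖mk A x‖ + ε) * (‖mk A y‖ + ε)) (𝓝[>] 0)
        (𝓝 (‖mk A x‖ * ‖mk A y‖)) := by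
      have : Continuous fun ε : ℝ => (‖mk A x‖ + ε) * (‖mk A y‖ + ε) := by fun_prop
      simpa using (this.tendsto 0).mono_left nhdsWithin_le_nhds
    exact ge_of_tendsto hlim (eventually_mem_nhdsWithin.mono fun ε hε => key ε hε)

instance : StarRing (ProdModSum A) where
  star_involutive := ind fun x => congrArg (mk A) (star_star x)
  star_mul := ind fun x => ind fun y => congrArg (mk A) (star_mul x y)
  star_add := ind fun x => ind fun y => congrArg (mk A) (star_add x y)

instance : CStarRing (ProdModSum A) where
  norm_mul_self_le := ind fun x => by
    rw [← mk_star, ← mk_mul]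
    refine le_of_forall_pos_le_add fun ε hε => ?_
    have h : ‖mk A x‖ ≤ √(‖mk A (star x * x)‖ + ε) := by
      refine norm_mk_le_of_eventually (Real.sqrt_nonneg _) ?_
      filter_upwards [eventually_norm_le (star x * x) hε] with k hk
      rw [lp.infty_coeFn_mul, Pi.mul_apply, lp.star_apply, CStarRing.norm_star_mul_self] at hk
      exact Real.le_sqrt_of_sq_le (by rwa [sq])
    rw [← sq]
    exact (Real.le_sqrt (norm_nonneg _) (by positivity)).1 h

instance : IsScalarTower ℂ (ProdModSum A) (ProdModSum A) where
  smul_assoc c := ind fun x => ind fun y => congrArg (mk A) (smul_mul_assoc c x y)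

instance : SMulCommClass ℂ (ProdModSum A) (ProdModSum A) where
  smul_comm c := ind fun x => ind fun y => congrArg (mk A) (mul_smul_comm c x y).symm

instance : StarModule ℂ (ProdModSum A) where
  star_smul c := ind fun x => congrArg (mk A) (star_smul c x)

instance : NonUnitalCStarAlgebra (ProdModSum A) where

end ProdModSum

end ProdModSum

/-! ### MF algebras -/

/-- An MF algebra: a separable C*-algebra with an embedding (an injective `*`-homomorphism) into
`∏ₖ M_{nₖ}(ℂ) / ∑ₖ M_{nₖ}(ℂ)` for some sequence of positive integers `nₖ`. Here `Mₙ(ℂ)` carries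
the operator norm. -/
def IsMF (A : Type u) [NonUnitalCStarAlgebra A] : Prop :=
  TopologicalSpace.SeparableSpace A ∧
    ∃ n : ℕ → ℕ, (∀ k, 0 < n k) ∧
      ∃ φ : A →⋆ₙₐ[ℂ] ProdModSum (fun k => Matrix (Fin (n k)) (Fin (n k)) ℂ),
        Function.Injective φ

/-! ### Quasidiagonal C*-algebras -/

/-- A set `S` of bounded operators on a Hilbert space is quasidiagonal if there is an increasing
sequence of finite-rank (orthogonal) projections tending strongly to the identity and commuting
asymptotically in norm with each member of `S`. -/
def IsQuasidiagonalSet {H : Type u} [NormedAddCommGroup H] [InnerProductSpace ℂ H]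
    [CompleteSpace H] (S : Set (H →L[ℂ] H)) : Prop :=
  ∃ p : ℕ → H →L[ℂ] H,
    (∀ i, IsStarProjection (p i)) ∧
    (∀ i, FiniteDimensional ℂ (p i).range) ∧
    Monotone p ∧
    (∀ ξ : H, Tendsto (fun i => p i ξ) atTop (𝓝 ξ)) ∧
    ∀ x ∈ S, Tendsto (fun i => ‖x * p i - p i * x‖) atTop (𝓝 0)

/-- An abstract separable C*-algebra `A` is quasidiagonal if it has a faithful `*`-representation
`π` on a Hilbert space `H` such that `π(A)` is a quasidiagonal set of operators. (The projections
force `H` to be separable, so the universe of `H` is immaterial.) -/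
def IsQuasidiagonal (A : Type u) [NonUnitalCStarAlgebra A] : Prop :=
  TopologicalSpace.SeparableSpace A ∧
    ∃ (H : Type u) (_ : NormedAddCommGroup H) (_ : InnerProductSpace ℂ H) (_ : CompleteSpace H)
      (π : A →⋆ₙₐ[ℂ] (H →L[ℂ] H)),
      Function.Injective π ∧ IsQuasidiagonalSet (Set.range π)

/-! ### The minimal tensor product -/

/-- A `*`-representation of `A` on a complex Hilbert space. The Hilbert space lives in the universe
of `A`, as the universal representation of `A` does. -/
structure HilbertRep (A : Type u) [NonUnitalCStarAlgebra A] where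
  /-- The Hilbert space. -/
  H : Type u
  [normedAddCommGroup : NormedAddCommGroup H]
  [innerProductSpace : InnerProductSpace ℂ H]
  [completeSpace : CompleteSpace H]
  /-- The `*`-homomorphism into the bounded operators. -/
  π : A →⋆ₙₐ[ℂ] (H →L[ℂ] H)

attribute [instance] HilbertRep.normedAddCommGroup HilbertRep.innerProductSpace
  HilbertRep.completeSpace

section HilbertTensor

variable (H : Type u) [NormedAddCommGroup H] [InnerProductSpace ℂ H]
  (K : Type v) [NormedAddCommGroup K] [InnerProductSpace ℂ K]

/-- The Hilbert space tensor product of `H` and `K`: the completion of the algebraic one. -/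
abbrev HilbertTensor : Type (max u v) := UniformSpace.Completion (H ⊗[ℂ] K)

variable {H K}

/-- The operator `S ⊗ T` on the Hilbert space tensor product, the continuous extension of
`ξ ⊗ η ↦ S ξ ⊗ T η`. -/
def opTensor (S : H →L[ℂ] H) (T : K →L[ℂ] K) : HilbertTensor H K →L[ℂ] HilbertTensor H K :=
  (TensorProduct.mapL S T).completion

lemma norm_opTensor_le (S : H →L[ℂ] H) (T : K →L[ℂ] K) : ‖opTensor S T‖ ≤ ‖S‖ * ‖T‖ := by
  refine ContinuousLinearMap.opNorm_le_bound _ (by positivity) fun x => ?_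
  induction x using UniformSpace.Completion.induction_on with
  | hp => exact isClosed_le (by fun_prop) (by fun_prop)
  | ih x =>
    rw [opTensor, ContinuousLinearMap.completion_apply_coe, UniformSpace.Completion.norm_coe,
      UniformSpace.Completion.norm_coe]
    exact (ContinuousLinearMap.le_opNorm _ _).trans
      (mul_le_mul_of_nonneg_right (TensorProduct.norm_mapL_le S T) (norm_nonneg _))

end HilbertTensor

section MinTensor

variable (A : Type u) [NonUnitalCStarAlgebra A] (B : Type v) [NonUnitalCStarAlgebra B]

variable {A B} in
/-- The C*-algebra `B(H_π ⊗ K_ρ)` for a pair of `*`-representations `π` of `A` and `ρ` of `B`. -/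
def RepOperators (r : HilbertRep A × HilbertRep B) : Type (max u v) :=
  HilbertTensor r.1.H r.2.H →L[ℂ] HilbertTensor r.1.H r.2.H

instance (r : HilbertRep A × HilbertRep B) : CStarAlgebra (RepOperators r) :=
  inferInstanceAs (CStarAlgebra (HilbertTensor r.1.H r.2.H →L[ℂ] HilbertTensor r.1.H r.2.H))

/-- The C*-algebra `∏ B(H_π ⊗ K_ρ)` over all pairs of `*`-representations `π` of `A` and `ρ`
of `B`, with the supremum norm. -/
abbrev RepProduct : Type (max (u + 1) (v + 1)) :=
  lp (fun r : HilbertRep A × HilbertRep B => RepOperators r) ∞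

variable {A B}

/-- The elementary tensor `a ⊗ b`, acting as `π(a) ⊗ ρ(b)` for each pair `(π, ρ)` of
`*`-representations. -/
def elemTensor (a : A) (b : B) : RepProduct A B :=
  ⟨fun r => opTensor (r.1.π a) (r.2.π b), memℓp_infty ⟨‖a‖ * ‖b‖, by
    rintro _ ⟨r, rfl⟩
    exact (norm_opTensor_le _ _).trans (mul_le_mul (NonUnitalStarAlgHom.norm_apply_le r.1.π a)
      (NonUnitalStarAlgHom.norm_apply_le r.2.π b) (norm_nonneg _) (norm_nonneg _))⟩⟩

variable (A B)

/-- The minimal (spatial) tensor product of two C*-algebras: the C*-algebra generated by the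
elementary tensors `a ⊗ b`, that is, the completion of the algebraic tensor product for the norm
`‖∑ aᵢ ⊗ bᵢ‖ = sup ‖∑ π(aᵢ) ⊗ ρ(bᵢ)‖`, the supremum being over all pairs of
`*`-representations `π` of `A` and `ρ` of `B`. -/
def MinTensor : NonUnitalStarSubalgebra ℂ (RepProduct A B) :=
  (NonUnitalStarAlgebra.adjoin ℂ {x | ∃ a b, x = elemTensor a b}).topologicalClosure

instance : NonUnitalCStarAlgebra (MinTensor A B) :=
  NonUnitalStarSubalgebra.nonUnitalCStarAlgebra (MinTensor A B)
    (h_closed := NonUnitalStarSubalgebra.isClosed_topologicalClosure _)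

end MinTensor

end

/-!
The minimal norm on `A ⊙ B` is attained at any pair of faithful representations. For `A` take the
quasidiagonal one, with projections `pᵢ` of rank `mᵢ`. Compressing `σ(a) ⊗ b` to the range of `pᵢ`
gives linear maps `A ⊙ B → M_{mᵢ}(B)`: they are asymptotically multiplicative because the `pᵢ`
asymptotically commute with `σ(A)`, and asymptotically isometric because `pᵢ → 1` strongly. Hence
`A ⊗_min B` embeds into `∏ᵢ M_{mᵢ}(B) / ∑ᵢ M_{mᵢ}(B)`.

Being MF is a local property of a separable algebra: each nonzero element survives in an almost
`*`-homomorphism, on a given finite set, into a full matrix algebra. This property passes from `B`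
to `M_m(B)` and from the `M_{mᵢ}(B)` to subalgebras of `∏ᵢ M_{mᵢ}(B) / ∑ᵢ M_{mᵢ}(B)`.

A faithful representation of `B` comes from the GNS construction, applied to ultralimits of vector
functionals on the matrix algebras.
-/

noncomputable section

namespace ProdModSum

variable {E : ℕ → Type u} [∀ k, NonUnitalCStarAlgebra (E k)]

lemma mk_eq_mk_iff_tendsto {x y : lp E ∞} :
    mk E x = mk E y ↔ Tendsto (fun k => ‖x k - y k‖) atTop (𝓝 0) :=
  mk_eq_mk.trans mem_sumIdeal

lemma frequently_le_norm (x : lp E ∞) {ε : ℝ} (hε : 0 < ε) :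
    ∃ᶠ k in atTop, ‖mk E x‖ - ε ≤ ‖x k‖ := by
  intro h
  have h' : ∀ᶠ k in atTop, ‖x k‖ ≤ ‖mk E x‖ - ε := h.mono fun k hk => (not_le.1 hk).le
  obtain ⟨k, hk⟩ := h'.exists
  linarith [norm_mk_le_of_eventually ((norm_nonneg _).trans hk) h']

lemma norm_mk_eq {x : lp E ∞} {r : ℝ} (hle : ∀ ε > 0, ∀ᶠ k in atTop, ‖x k‖ ≤ r + ε)
    (hge : ∀ ε > 0, ∃ᶠ k in atTop, r - ε ≤ ‖x k‖) : ‖mk E x‖ = r := by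
  refine le_antisymm (le_of_forall_pos_le_add fun ε hε => ?_)
    (le_of_forall_pos_le_add fun ε hε => ?_)
  · obtain ⟨k, hk⟩ := (hle ε hε).exists
    exact norm_mk_le_of_eventually ((norm_nonneg _).trans hk) (hle ε hε)
  · obtain ⟨k, hk, hk'⟩ :=
      ((hge _ (half_pos hε)).and_eventually (eventually_norm_le x (half_pos hε))).exists
    linarith

end ProdModSum

section Asymptotic

variable {E : ℕ → Type u} [∀ k, NonUnitalCStarAlgebra (E k)]

lemma memℓp_infty_of_eventually_norm_le {x : ∀ k, E k} {r : ℝ}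
    (h : ∀ᶠ k in atTop, ‖x k‖ ≤ r) : Memℓp x ∞ :=
  memℓp_infty (isBoundedUnder_of_eventually_le h).bddAbove_range

/-- Additive maps `s k` forming an asymptotically multiplicative sequence, pointwise bounded so
that `⟨s k x⟩ₖ` has a class in `∏ₖ Eₖ / ∑ₖ Eₖ`. -/
structure IsAsymptoticRingHom {R : Type*} [NonUnitalRing R] (s : ∀ k, R →+ E k) : Prop where
  memℓp : ∀ x, Memℓp (fun k => s k x) ∞
  tendsto_map_mul : ∀ x y, Tendsto (fun k => ‖s k (x * y) - s k x * s k y‖) atTop (𝓝 0)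

/-- The ring homomorphism `x ↦ [⟨s k x⟩ₖ]` defined by an asymptotically multiplicative sequence. -/
def IsAsymptoticRingHom.toProdModSum {R : Type*} [NonUnitalRing R] {s : ∀ k, R →+ E k}
    (hs : IsAsymptoticRingHom s) : R →ₙ+* ProdModSum E where
  toFun x := ProdModSum.mk E ⟨fun k => s k x, hs.memℓp x⟩
  map_zero' := by
    rw [← (ProdModSum.mk E).map_zero]
    congr 1
    ext k
    exact (s k).map_zero
  map_add' x y := by
    rw [← map_add]
    congr 1
    ext k
    exact (s k).map_add x y
  map_mul' x y := by
    rw [← ProdModSum.mk_mul]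
    exact ProdModSum.mk_eq_mk_iff_tendsto.2 (hs.tendsto_map_mul x y)

lemma ProdModSum.exists_linearMap_lift {V : Type*} [AddCommGroup V] [Module ℂ V]
    (φ : V →ₗ[ℂ] ProdModSum E) :
    ∃ L : V →ₗ[ℂ] lp E ∞, ∀ x, ProdModSum.mk E (L x) = φ x := by
  obtain ⟨g, hg⟩ := (ProdModSum.mk E).exists_rightInverse_of_surjective
    (LinearMap.range_eq_top.2 ProdModSum.mk_surjective)
  exact ⟨g ∘ₗ φ, fun x => LinearMap.congr_fun hg (φ x)⟩

end Asymptotic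

section Extension

lemma exists_isometry_extension {V X Y : Type*} [MetricSpace X] [MetricSpace Y]
    [CompleteSpace Y] {α : V → X} (hα : DenseRange α) {ψ : V → Y}
    (h : ∀ v w, dist (ψ v) (ψ w) = dist (α v) (α w)) :
    ∃ f : X → Y, Isometry f ∧ ∀ v, f (α v) = ψ v := by
  let _ : PseudoMetricSpace V := .induced α inferInstance
  have hi : IsUniformInducing α := ⟨rfl⟩
  have hψ : UniformContinuous ψ := (Isometry.of_dist_eq h).uniformContinuous
  have hf := (uniformContinuous_uniformly_extend hi hα hψ).continuous
  have hfα := uniformly_extend_of_ind hi hα hψ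
  refine ⟨_, Isometry.of_dist_eq fun x y => ?_, hfα⟩
  exact hα.induction_on₂ (p := fun x y => dist (hi.isDenseInducing hα |>.extend ψ x)
    (hi.isDenseInducing hα |>.extend ψ y) = dist x y)
    (isClosed_eq (by fun_prop) (by fun_prop)) (fun v w => by rw [hfα, hfα, h]) x y

/-- The additive extension of `g` is automatically real linear, so that `g` only has to respect
multiplication by `I`. -/
theorem exists_injective_starAlgHom_of_denseRange {R : Type*} [NonUnitalRing R]
    {C : Type u} [NonUnitalCStarAlgebra C] {P : Type v} [NonUnitalCStarAlgebra P]
    {ι : R →ₙ+* C} (hι : DenseRange ι) (g : R →ₙ+* P)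
    (hstar : ∀ x, ∃ y, ι y = star (ι x) ∧ g y = star (g x))
    (hI : ∀ x, ∃ y, ι y = Complex.I • ι x ∧ g y = Complex.I • g x)
    (hnorm : ∀ x, ‖g x‖ = ‖ι x‖) :
    ∃ φ : C →⋆ₙₐ[ℂ] P, Function.Injective φ := by
  obtain ⟨f, hf, hfι⟩ := exists_isometry_extension hι (ψ := g) fun x y => by
    rw [dist_eq_norm, dist_eq_norm, ← map_sub, ← map_sub, hnorm]
  have hc : Continuous f := hf.continuous
  have hadd : ∀ x y, f (x + y) = f x + f y := fun x y =>
    hι.induction_on₂ (p := fun x y => f (x + y) = f x + f y)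
      (isClosed_eq (by fun_prop) (by fun_prop))
      (fun x y => by rw [← map_add, hfι, hfι, hfι, map_add]) x y
  have hmul : ∀ x y, f (x * y) = f x * f y := fun x y =>
    hι.induction_on₂ (p := fun x y => f (x * y) = f x * f y)
      (isClosed_eq (by fun_prop) (by fun_prop))
      (fun x y => by rw [← map_mul, hfι, hfι, hfι, map_mul]) x y
  have hstar' : ∀ x, f (star x) = star (f x) := fun x =>
    hι.induction_on (p := fun x => f (star x) = star (f x)) x
      (isClosed_eq (by fun_prop) (by fun_prop)) fun x => by
        obtain ⟨y, hy, hgy⟩ := hstar x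
        rw [← hy, hfι, hfι, hgy]
  have hI' : ∀ x, f (Complex.I • x) = Complex.I • f x := fun x =>
    hι.induction_on (p := fun x => f (Complex.I • x) = Complex.I • f x) x
      (isClosed_eq (by fun_prop) (by fun_prop)) fun x => by
        obtain ⟨y, hy, hgy⟩ := hI x
        rw [← hy, hfι, hfι, hgy]
  let fR : C →L[ℝ] P := (AddMonoidHom.mk' f hadd).toRealLinearMap hc
  have hreal : ∀ (r : ℝ) x, f ((r : ℂ) • x) = (r : ℂ) • f x := fun r x => fR.map_smul r x
  have hsmul : ∀ (z : ℂ) x, f (z • x) = z • f x := fun z x => by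
    rw [← Complex.re_add_im z, add_smul, add_smul, hadd, mul_smul, mul_smul, hreal, hreal, hI']
  exact ⟨{ toFun := f
           map_smul' := hsmul
           map_zero' := fR.map_zero
           map_add' := hadd
           map_mul' := hmul
           map_star' := hstar' }, hf.injective⟩

theorem exists_embedding_prodModSum_of_denseRange {R : Type*} [NonUnitalRing R]
    {C : Type u} [NonUnitalCStarAlgebra C] {E : ℕ → Type v} [∀ k, NonUnitalCStarAlgebra (E k)]
    {ι : R →ₙ+* C} (hι : DenseRange ι) (s : ∀ k, R →+ E k)
    (hmul : ∀ x y, Tendsto (fun k => ‖s k (x * y) - s k x * s k y‖) atTop (𝓝 0))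
    (hstar : ∀ x, ∃ y, ι y = star (ι x) ∧
      Tendsto (fun k => ‖s k y - star (s k x)‖) atTop (𝓝 0))
    (hI : ∀ x, ∃ y, ι y = Complex.I • ι x ∧ ∀ k, s k y = Complex.I • s k x)
    (hle : ∀ x, ∀ ε > 0, ∀ᶠ k in atTop, ‖s k x‖ ≤ ‖ι x‖ + ε)
    (hge : ∀ x, ∀ ε > 0, ∃ᶠ k in atTop, ‖ι x‖ - ε ≤ ‖s k x‖) :
    ∃ φ : C →⋆ₙₐ[ℂ] ProdModSum E, Function.Injective φ := by
  have hs : IsAsymptoticRingHom s :=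
    ⟨fun x => memℓp_infty_of_eventually_norm_le (hle x 1 one_pos), hmul⟩
  refine exists_injective_starAlgHom_of_denseRange hι hs.toProdModSum (fun x => ?_)
    (fun x => ?_) fun x => ProdModSum.norm_mk_eq (hle x) (hge x)
  · obtain ⟨y, hy, hsy⟩ := hstar x
    exact ⟨y, hy, ProdModSum.mk_eq_mk_iff_tendsto.2 hsy⟩
  · obtain ⟨y, hy, hsy⟩ := hI x
    refine ⟨y, hy, (congrArg (ProdModSum.mk E) ?_).trans (map_smul (ProdModSum.mk E) _ _)⟩
    ext k
    exact hsy k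

end Extension

/-! ### A local characterization of MF algebras -/

section LocallyMF

/-- On the set `F`, the linear map `θ` is contractive, multiplicative and `*`-preserving up to an
error of `ε` in norm. -/
structure IsAlmostStarHom {C : Type*} {E : Type*} [NonUnitalCStarAlgebra C]
    [NonUnitalCStarAlgebra E] (θ : C →ₗ[ℂ] E) (F : Set C) (ε : ℝ) : Prop where
  norm_le : ∀ x ∈ F, ‖θ x‖ ≤ ‖x‖ + ε
  norm_map_mul_sub_le : ∀ x ∈ F, ∀ y ∈ F, ‖θ (x * y) - θ x * θ y‖ ≤ ε
  norm_map_star_sub_le : ∀ x ∈ F, ‖θ (star x) - star (θ x)‖ ≤ ε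

namespace IsAlmostStarHom

variable {C D E : Type*} [NonUnitalCStarAlgebra C] [NonUnitalCStarAlgebra D]
  [NonUnitalCStarAlgebra E]

lemma zero (F : Set C) {ε : ℝ} (hε : 0 ≤ ε) : IsAlmostStarHom (0 : C →ₗ[ℂ] E) F ε where
  norm_le x _ := by simpa using add_nonneg (norm_nonneg x) hε
  norm_map_mul_sub_le x _ y _ := by simpa using hε
  norm_map_star_sub_le x _ := by simpa using hε

lemma of_starAlgHom (φ : C →⋆ₙₐ[ℂ] E) (F : Set C) {ε : ℝ} (hε : 0 ≤ ε) :
    IsAlmostStarHom (φ : C →ₗ[ℂ] E) F ε where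
  norm_le x _ := (NonUnitalStarAlgHom.norm_apply_le φ x).trans (le_add_of_nonneg_right hε)
  norm_map_mul_sub_le x _ y _ := by simpa using hε
  norm_map_star_sub_le x _ := by simpa [map_star] using hε

/-- The elements on which a linear map has to be controlled in order to control its composition
with `θ` on `F`: the values of `θ` on `F` and the defects of `θ` on `F`. -/
def testSet (θ : C →ₗ[ℂ] D) (F : Set C) : Set D :=
  θ '' F ∪ (Set.image2 (fun x y => θ (x * y) - θ x * θ y) F F ∪
    (fun x => θ (star x) - star (θ x)) '' F)

lemma finite_testSet (θ : C →ₗ[ℂ] D) {F : Set C} (hF : F.Finite) : (testSet θ F).Finite :=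
  (hF.image _).union ((hF.image2 _ hF).union (hF.image _))

lemma comp {θ : C →ₗ[ℂ] D} {η : D →ₗ[ℂ] E} {F : Set C} {δ ε : ℝ} (hε : 0 ≤ ε)
    (hη : IsAlmostStarHom η (testSet θ F) ε) (hθ : IsAlmostStarHom θ F δ) :
    IsAlmostStarHom (η ∘ₗ θ) F (δ + 2 * ε) where
  norm_le x hx := by
    have h₁ := hη.norm_le _ (.inl (Set.mem_image_of_mem θ hx))
    have h₂ := hθ.norm_le x hx
    rw [LinearMap.comp_apply]
    linarith
  norm_map_mul_sub_le x hx y hy := by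
    have h₁ := hη.norm_le _ (.inr (.inl (Set.mem_image2_of_mem hx hy)))
    have h₂ := hη.norm_map_mul_sub_le _ (.inl (Set.mem_image_of_mem θ hx)) _
      (.inl (Set.mem_image_of_mem θ hy))
    have h₃ := hθ.norm_map_mul_sub_le x hx y hy
    calc ‖η (θ (x * y)) - η (θ x) * η (θ y)‖
        = ‖η (θ (x * y) - θ x * θ y) + (η (θ x * θ y) - η (θ x) * η (θ y))‖ := by
          rw [map_sub, sub_add_sub_cancel]
      _ ≤ δ + 2 * ε := (norm_add_le _ _).trans (by linarith)
  norm_map_star_sub_le x hx := by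
    have h₁ := hη.norm_le _ (.inr (.inr (Set.mem_image_of_mem _ hx)))
    have h₂ := hη.norm_map_star_sub_le _ (.inl (Set.mem_image_of_mem θ hx))
    have h₃ := hθ.norm_map_star_sub_le x hx
    calc ‖η (θ (star x)) - star (η (θ x))‖
        = ‖η (θ (star x) - star (θ x)) + (η (star (θ x)) - star (η (θ x)))‖ := by
          rw [map_sub, sub_add_sub_cancel]
      _ ≤ δ + 2 * ε := (norm_add_le _ _).trans (by linarith)

end IsAlmostStarHom

lemma eventually_isAlmostStarHom {E : ℕ → Type u} [∀ k, NonUnitalCStarAlgebra (E k)]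
    {C : Type v} [NonUnitalCStarAlgebra C] (φ : C →⋆ₙₐ[ℂ] ProdModSum E) {L : C →ₗ[ℂ] lp E ∞}
    (hL : ∀ x, ProdModSum.mk E (L x) = φ x) {F : Set C} (hF : F.Finite) {ε : ℝ} (hε : 0 < ε) :
    ∀ᶠ k in atTop, IsAlmostStarHom (lp.evalₗ E ∞ k ∘ₗ L) F ε := by
  have hnorm : ∀ᶠ k in atTop, ∀ x ∈ F, ‖L x k‖ ≤ ‖x‖ + ε :=
    (eventually_all_finite hF).2 fun x _ => by
      filter_upwards [ProdModSum.eventually_norm_le (L x) hε] with k hk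
      rw [hL] at hk
      exact hk.trans (by gcongr; exact NonUnitalStarAlgHom.norm_apply_le φ x)
  have hmul : ∀ᶠ k in atTop, ∀ x ∈ F, ∀ y ∈ F, ‖L (x * y) k - L x k * L y k‖ ≤ ε :=
    (eventually_all_finite hF).2 fun x _ => (eventually_all_finite hF).2 fun y _ =>
      (ProdModSum.mk_eq_mk_iff_tendsto (y := L x * L y).1 (by
        rw [ProdModSum.mk_mul, hL, hL, hL, map_mul])).eventually_le_const hε
  have hstar : ∀ᶠ k in atTop, ∀ x ∈ F, ‖L (star x) k - star (L x k)‖ ≤ ε :=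
    (eventually_all_finite hF).2 fun x _ =>
      (ProdModSum.mk_eq_mk_iff_tendsto (y := star (L x)).1 (by
        rw [ProdModSum.mk_star, hL, hL, map_star])).eventually_le_const hε
  filter_upwards [hnorm, hmul, hstar] with k h₁ h₂ h₃ using ⟨h₁, h₂, h₃⟩

/-- The local form of the MF property: linear maps into matrix algebras that are almost
`*`-homomorphisms on a given finite set and almost preserve the norm of a given element. -/
def IsLocallyMF (C : Type u) [NonUnitalCStarAlgebra C] : Prop :=
  ∀ F : Set C, F.Finite → ∀ ε > 0, ∀ x₀ : C,
    ∃ (n : ℕ) (θ : C →ₗ[ℂ] Matrix (Fin n) (Fin n) ℂ),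
      IsAlmostStarHom θ F ε ∧ ‖x₀‖ - ε ≤ ‖θ x₀‖

namespace IsLocallyMF

lemma of_starAlgHom_matrix {C : Type u} [NonUnitalCStarAlgebra C] {n : ℕ}
    (φ : C →⋆ₙₐ[ℂ] Matrix (Fin n) (Fin n) ℂ) (hφ : Function.Injective φ) : IsLocallyMF C :=
  fun F _ _ hε x₀ => ⟨n, φ, .of_starAlgHom φ F hε.le,
    (sub_le_self _ hε.le).trans (NonUnitalStarAlgHom.norm_map φ hφ x₀).ge⟩

lemma of_prodModSum {E : ℕ → Type u} [∀ k, NonUnitalCStarAlgebra (E k)]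
    {C : Type v} [NonUnitalCStarAlgebra C] (hE : ∀ k, IsLocallyMF (E k))
    (φ : C →⋆ₙₐ[ℂ] ProdModSum E) (hφ : Function.Injective φ) : IsLocallyMF C := by
  intro F hF ε hε x₀
  obtain ⟨L, hL⟩ := ProdModSum.exists_linearMap_lift (φ : C →ₗ[ℂ] ProdModSum E)
  have hε₃ : 0 < ε / 3 := by positivity
  obtain ⟨k, hk₀, hk⟩ := ((ProdModSum.frequently_le_norm (L x₀) hε₃).and_eventually
    (eventually_isAlmostStarHom φ hL hF hε₃)).exists
  replace hk₀ : ‖x₀‖ - ε / 3 ≤ ‖L x₀ k‖ := by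
    rw [hL] at hk₀
    exact (congrArg (· - ε / 3) (NonUnitalStarAlgHom.norm_map φ hφ x₀)).ge.trans hk₀
  obtain ⟨n, η, hη, hη₀⟩ := hE k _ (IsAlmostStarHom.finite_testSet _ hF) _ hε₃ (L x₀ k)
  refine ⟨n, η ∘ₗ lp.evalₗ E ∞ k ∘ₗ L, ?_, ?_⟩
  · convert hη.comp hε₃.le hk using 1
    ring
  · change ‖x₀‖ - ε ≤ ‖η (L x₀ k)‖
    linarith

lemma exists_pos {C : Type u} [NonUnitalCStarAlgebra C] (h : IsLocallyMF C) {F : Set C}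
    (hF : F.Finite) {ε : ℝ} (hε : 0 < ε) (x₀ : C) :
    ∃ n, 0 < n ∧ ∃ θ : C →ₗ[ℂ] Matrix (Fin n) (Fin n) ℂ,
      IsAlmostStarHom θ F ε ∧ ‖x₀‖ - ε ≤ ‖θ x₀‖ := by
  obtain ⟨n, θ, hθ, hθ₀⟩ := h F hF ε hε x₀
  rcases Nat.eq_zero_or_pos n with rfl | hn
  · rw [Subsingleton.elim (θ x₀) 0, norm_zero] at hθ₀
    exact ⟨1, one_pos, 0, .zero F hε.le, by simpa using hθ₀⟩
  · exact ⟨n, hn, θ, hθ, hθ₀⟩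

end IsLocallyMF

/-- Enumerating the finite sets and the distinguished elements at once, each element being
distinguished infinitely often, produces maps which asymptotically preserve every norm. -/
lemma IsLocallyMF.exists_seq {C : Type u} [NonUnitalCStarAlgebra C] (h : IsLocallyMF C)
    (d : ℕ → C) :
    ∃ n : ℕ → ℕ, (∀ k, 0 < n k) ∧
      ∃ θ : ∀ k, C →ₗ[ℂ] Matrix (Fin (n k)) (Fin (n k)) ℂ,
        (∀ k, IsAlmostStarHom (θ k) (d '' Set.Iic k) (1 / (k + 1))) ∧
        ∀ a, ∃ᶠ k in atTop, ‖d a‖ - 1 / (k + 1) ≤ ‖θ k (d a)‖ := by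
  choose n hn θ hθ hθ₀ using fun k : ℕ =>
    h.exists_pos ((Set.finite_Iic k).image d) (ε := 1 / (k + 1)) Nat.one_div_pos_of_nat
      (d (Nat.unpair k).1)
  refine ⟨n, hn, θ, hθ, fun a => frequently_atTop.2 fun N =>
    ⟨Nat.pair a N, Nat.right_le_pair a N, ?_⟩⟩
  simpa only [Nat.unpair_pair] using hθ₀ (Nat.pair a N)

lemma exists_countable_superset_closed {α ι : Type*} [Countable ι] (f : ι → α → α → α)
    {D : Set α} (hD : D.Countable) :
    ∃ S, D ⊆ S ∧ S.Countable ∧ ∀ i, ∀ x ∈ S, ∀ y ∈ S, f i x y ∈ S := by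
  let step : Set α → Set α := fun T => T ∪ ⋃ i, Set.image2 (f i) T T
  let T : ℕ → Set α := fun n => step^[n] D
  have hT : ∀ n, T (n + 1) = step (T n) := fun n => Function.iterate_succ_apply' step n D
  have hmono : Monotone T := monotone_nat_of_le_succ fun n => by
    rw [hT]
    exact Set.subset_union_left
  have hc : ∀ n, (T n).Countable := fun n => by
    induction n with
    | zero => exact hD
    | succ n ih =>
      rw [hT]
      exact ih.union (Set.countable_iUnion fun i => ih.image2 ih _)
  refine ⟨⋃ n, T n, Set.subset_iUnion T 0, Set.countable_iUnion hc, fun i x hx y hy => ?_⟩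
  obtain ⟨a, ha⟩ := Set.mem_iUnion.1 hx
  obtain ⟨b, hb⟩ := Set.mem_iUnion.1 hy
  refine Set.mem_iUnion.2 ⟨max a b + 1, ?_⟩
  rw [hT]
  exact .inr (Set.mem_iUnion.2 ⟨i, Set.mem_image2_of_mem (hmono (le_max_left a b) ha)
    (hmono (le_max_right a b) hb)⟩)

lemma exists_countable_dense_nonUnitalSubring (C : Type u) [NonUnitalCStarAlgebra C]
    [TopologicalSpace.SeparableSpace C] :
    ∃ S : NonUnitalSubring C, (S : Set C).Countable ∧ Dense (S : Set C) ∧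
      (∀ x ∈ S, star x ∈ S) ∧ ∀ x ∈ S, Complex.I • x ∈ S := by
  obtain ⟨D, hDc, hDd⟩ := TopologicalSpace.exists_countable_dense C
  let op : Fin 4 → C → C → C :=
    ![fun x y => x - y, fun x y => x * y, fun x _ => star x, fun x _ => Complex.I • x]
  obtain ⟨S, hDS, hSc, hS⟩ := exists_countable_superset_closed op hDc
  have hsub : ∀ {x y}, x ∈ S → y ∈ S → x - y ∈ S := fun hx hy => hS 0 _ hx _ hy
  obtain ⟨x₀, hx₀⟩ := hDd.nonempty
  have hzero : (0 : C) ∈ S := by simpa using hsub (hDS hx₀) (hDS hx₀)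
  have hneg : ∀ {x}, x ∈ S → -x ∈ S := fun hx => by simpa using hsub hzero hx
  exact ⟨{ carrier := S
           zero_mem' := hzero
           add_mem' := fun hx hy => by simpa using hsub hx (hneg hy)
           neg_mem' := hneg
           mul_mem' := fun hx hy => hS 1 _ hx _ hy }, hSc, hDd.mono hDS,
    fun x hx => hS 2 x hx x hx, fun x hx => hS 3 x hx x hx⟩

theorem IsLocallyMF.isMF {C : Type u} [NonUnitalCStarAlgebra C]
    [TopologicalSpace.SeparableSpace C] (h : IsLocallyMF C) : IsMF C := by
  obtain ⟨S, hSc, hSd, hSstar, hSI⟩ := exists_countable_dense_nonUnitalSubring C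
  obtain ⟨d, hd⟩ := hSc.exists_eq_range hSd.nonempty
  obtain ⟨n, hn, θ, hθ, hθ₀⟩ := h.exists_seq d
  have hlim : Tendsto (fun k : ℕ => 1 / ((k : ℝ) + 1)) atTop (𝓝 0) :=
    tendsto_one_div_add_atTop_nhds_zero_nat
  have hmem : ∀ x : S, ∀ᶠ k in atTop, (x : C) ∈ d '' Set.Iic k := fun x => by
    obtain ⟨a, ha⟩ : (x : C) ∈ Set.range d := hd ▸ x.2
    filter_upwards [eventually_ge_atTop a] with k hk using ⟨a, hk, ha⟩
  refine ⟨inferInstance, n, hn, exists_embedding_prodModSum_of_denseRange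
    (ι := NonUnitalSubringClass.subtype S) hSd.denseRange_val
    (fun k => (θ k).toAddMonoidHom.comp (NonUnitalSubringClass.subtype S : S →+ C))
    (fun x y => ?_) (fun x => ⟨⟨_, hSstar x x.2⟩, rfl, ?_⟩)
    (fun x => ⟨⟨_, hSI x x.2⟩, rfl, fun k => (θ k).map_smul Complex.I x⟩)
    (fun x ε hε => ?_) (fun x ε hε => ?_)⟩
  · refine squeeze_zero' (.of_forall fun _ => norm_nonneg _) ?_ hlim
    filter_upwards [hmem x, hmem y] with k hx hy using (hθ k).norm_map_mul_sub_le x hx y hy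
  · refine squeeze_zero' (.of_forall fun _ => norm_nonneg _) ?_ hlim
    filter_upwards [hmem x] with k hx using (hθ k).norm_map_star_sub_le x hx
  · filter_upwards [hmem x, hlim.eventually_le_const hε] with k hx hkε
    exact ((hθ k).norm_le x hx).trans (by gcongr; rfl)
  · obtain ⟨a, ha⟩ : (x : C) ∈ Set.range d := hd ▸ x.2
    refine ((hθ₀ a).and_eventually (hlim.eventually_le_const hε)).mono fun k hk => ?_
    rw [ha] at hk
    exact (sub_le_sub_left hk.2 _).trans hk.1

end LocallyMF

/-! ### Matrix algebras over MF algebras -/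

section MatrixAmplification

variable {m : Type*} [Fintype m] {E : Type*} [NonUnitalCStarAlgebra E] [PartialOrder E]
  [StarOrderedRing E]

lemma cstarMatrix_norm_single_le [DecidableEq m] (s t : m) (x : E) :
    ‖CStarMatrix.ofMatrix (Matrix.single s t x)‖ ≤ ‖x‖ := by
  let diag : E →⋆ₙₐ[ℂ] CStarMatrix m m E :=
    { toFun := fun y => CStarMatrix.ofMatrix (Matrix.single t t y)
      map_zero' := Matrix.single_zero t t
      map_add' := Matrix.single_add t t
      map_smul' := fun c y => (Matrix.smul_single c t t y).symm
      map_mul' := fun y z => (Matrix.single_mul_single_same y t t t z).symm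
      map_star' := fun y => (Matrix.conjTranspose_single t t y).symm }
  have hdiag : star (CStarMatrix.ofMatrix (Matrix.single s t x)) *
      CStarMatrix.ofMatrix (Matrix.single s t x) = diag (star x * x) :=
    (congrArg (· * Matrix.single s t x) (Matrix.conjTranspose_single s t x)).trans
      (Matrix.single_mul_single_same (star x) t s t x)
  refine le_of_sq_le_sq ?_ (norm_nonneg x)
  rw [sq, sq, ← CStarRing.norm_star_mul_self, hdiag, ← CStarRing.norm_star_mul_self]
  exact NonUnitalStarAlgHom.norm_apply_le diag _

lemma cstarMatrix_norm_le_sum (M : CStarMatrix m m E) : ‖M‖ ≤ ∑ s, ∑ t, ‖M s t‖ := by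
  classical
  calc ‖M‖ = ‖∑ s, ∑ t, CStarMatrix.ofMatrix (Matrix.single s t (M s t))‖ :=
        congrArg norm (Matrix.matrix_eq_sum_single (CStarMatrix.ofMatrix.symm M))
    _ ≤ ∑ s, ∑ t, ‖M s t‖ := norm_sum_le_of_le _ fun s _ => norm_sum_le_of_le _ fun t _ =>
        cstarMatrix_norm_single_le s t _

lemma tendsto_norm_cstarMatrix_zero {ι : Type*} {l : Filter ι} {E : ι → Type*}
    [∀ i, NonUnitalCStarAlgebra (E i)] [∀ i, PartialOrder (E i)] [∀ i, StarOrderedRing (E i)]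
    {M : ∀ i, CStarMatrix m m (E i)} (h : ∀ s t, Tendsto (fun i => ‖M i s t‖) l (𝓝 0)) :
    Tendsto (fun i => ‖M i‖) l (𝓝 0) := by
  refine squeeze_zero (fun i => norm_nonneg _) (fun i => cstarMatrix_norm_le_sum (M i)) ?_
  simpa only [Finset.sum_const_zero] using tendsto_finsetSum Finset.univ fun s _ =>
    tendsto_finsetSum Finset.univ fun t _ => h s t

lemma norm_cstarMatrix_mapₙₐ {F : Type*} [NonUnitalCStarAlgebra F] [PartialOrder F]
    [StarOrderedRing F] (φ : E →⋆ₙₐ[ℂ] F) (hφ : Function.Injective φ) (M : CStarMatrix m m E) :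
    ‖CStarMatrix.mapₙₐ φ M‖ = ‖M‖ :=
  NonUnitalStarAlgHom.norm_map (CStarMatrix.mapₙₐ φ) (fun M N h => by
    ext s t
    exact hφ (congrFun (congrFun h s) t)) M

/-- The block matrix isomorphism `M_m(M_n(ℂ)) ≅ M_{mn}(ℂ)`. -/
def blockMatrixHom (m n : ℕ) :
    CStarMatrix (Fin m) (Fin m) (Matrix (Fin n) (Fin n) ℂ) →⋆ₙₐ[ℂ]
      Matrix (Fin (m * n)) (Fin (m * n)) ℂ :=
  let e := (Matrix.compAlgEquiv (Fin m) (Fin n) ℂ ℂ).trans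
    (Matrix.reindexAlgEquiv ℂ ℂ finProdFinEquiv)
  { toFun := fun M => e (CStarMatrix.ofMatrix.symm M)
    map_zero' := map_zero e
    map_add' := map_add e
    map_smul' := map_smul e
    map_mul' := map_mul e
    map_star' := fun _ => rfl }

lemma blockMatrixHom_injective (m n : ℕ) : Function.Injective (blockMatrixHom m n) :=
  ((Matrix.compAlgEquiv (Fin m) (Fin n) ℂ ℂ).trans
    (Matrix.reindexAlgEquiv ℂ ℂ finProdFinEquiv)).injective

end MatrixAmplification

section MatrixProdModSum

open scoped MatrixOrder

variable {m : Type*} [Fintype m] {E : ℕ → Type u} [∀ k, NonUnitalCStarAlgebra (E k)]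
  [∀ k, PartialOrder (E k)] [∀ k, StarOrderedRing (E k)] {B : Type v} [NonUnitalCStarAlgebra B]

lemma isAsymptoticRingHom_cstarMatrix_map {φ : B →⋆ₙₐ[ℂ] ProdModSum E} {L : B →ₗ[ℂ] lp E ∞}
    (hL : ∀ x, ProdModSum.mk E (L x) = φ x) :
    IsAsymptoticRingHom fun k => (CStarMatrix.mapₗ (lp.evalₗ E ∞ k ∘ₗ L) :
      CStarMatrix m m B →ₗ[ℂ] CStarMatrix m m (E k)).toAddMonoidHom where
  memℓp M := by
    refine memℓp_infty_of_eventually_norm_le (r := ∑ s, ∑ t, ‖L (M s t)‖) (.of_forall fun k => ?_)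
    exact (cstarMatrix_norm_le_sum _).trans (Finset.sum_le_sum fun s _ =>
      Finset.sum_le_sum fun t _ => lp.norm_apply_le_norm ENNReal.top_ne_zero _ k)
  tendsto_map_mul M N := by
    refine tendsto_norm_cstarMatrix_zero fun s t => ?_
    have hst : ProdModSum.mk E (L ((M * N) s t)) =
        ProdModSum.mk E (∑ l, L (M s l) * L (N l t)) := by
      simp only [CStarMatrix.mul_apply, map_sum, hL, map_mul, ProdModSum.mk_mul]
    refine (ProdModSum.mk_eq_mk_iff_tendsto.1 hst).congr fun k => ?_
    rw [lp.coeFn_sum, Finset.sum_apply]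
    rfl

theorem exists_embedding_cstarMatrix_prodModSum (φ : B →⋆ₙₐ[ℂ] ProdModSum E)
    (hφ : Function.Injective φ) :
    ∃ ψ : CStarMatrix m m B →⋆ₙₐ[ℂ] ProdModSum fun k => CStarMatrix m m (E k),
      Function.Injective ψ := by
  obtain ⟨L, hL⟩ := ProdModSum.exists_linearMap_lift (φ : B →ₗ[ℂ] ProdModSum E)
  replace hL : ∀ x, ProdModSum.mk E (L x) = φ x := hL
  have hs := isAsymptoticRingHom_cstarMatrix_map (m := m) hL
  let ψ : CStarMatrix m m B →⋆ₙₐ[ℂ] ProdModSum fun k => CStarMatrix m m (E k) :=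
    { hs.toProdModSum with
      map_smul' := fun c M => by
        refine (congrArg (ProdModSum.mk _) ?_).trans (map_smul (ProdModSum.mk _) c _)
        ext k : 2
        exact map_smul (CStarMatrix.mapₗ (lp.evalₗ E ∞ k ∘ₗ L)) c M
      map_star' := fun M => by
        refine ProdModSum.mk_eq_mk_iff_tendsto.2 (tendsto_norm_cstarMatrix_zero fun s t => ?_)
        refine ProdModSum.mk_eq_mk_iff_tendsto (x := L (star (M t s))) (y := star (L (M t s))).1 ?_
        rw [ProdModSum.mk_star, hL, hL, map_star] }
  refine ⟨ψ, (injective_iff_map_eq_zero ψ).2 fun M hM => ?_⟩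
  have hM' : Tendsto (fun k => ‖CStarMatrix.mapₗ (lp.evalₗ E ∞ k ∘ₗ L) M‖) atTop (𝓝 0) := by
    have h := ProdModSum.mk_eq_mk_iff_tendsto (y := 0).1 (hM.trans (map_zero _).symm)
    exact h.congr fun k => congrArg norm (sub_zero _)
  ext s t
  refine hφ ?_
  rw [CStarMatrix.zero_apply, map_zero, ← hL, ← map_zero (ProdModSum.mk E),
    ProdModSum.mk_eq_mk_iff_tendsto]
  refine squeeze_zero (fun k => norm_nonneg _) (fun k => ?_) hM'
  rw [lp.coeFn_zero, Pi.zero_apply, sub_zero]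
  exact CStarMatrix.norm_entry_le_norm (M := CStarMatrix.mapₗ (lp.evalₗ E ∞ k ∘ₗ L) M)

lemma IsMF.isLocallyMF_cstarMatrix [PartialOrder B] [StarOrderedRing B] (h : IsMF B) (m : ℕ) :
    IsLocallyMF (CStarMatrix (Fin m) (Fin m) B) := by
  obtain ⟨-, n, -, φ, hφ⟩ := h
  obtain ⟨ψ, hψ⟩ := exists_embedding_cstarMatrix_prodModSum (m := Fin m) φ hφ
  exact .of_prodModSum (fun k => .of_starAlgHom_matrix (blockMatrixHom m (n k))
    (blockMatrixHom_injective m (n k))) ψ hψ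

end MatrixProdModSum

/-! ### Faithful representations of MF algebras -/

section FaithfulRep

open scoped ComplexOrder InnerProductSpace

/-- A contractive positive functional on a C*-algebra, with positivity stated on the generators
`x* x` of the positive cone so that no order has to be chosen. -/
structure IsQuasiState {C : Type*} [NonUnitalCStarAlgebra C] (f : C →ₗ[ℂ] ℂ) : Prop where
  norm_le : ∀ x, ‖f x‖ ≤ ‖x‖
  nonneg : ∀ x, 0 ≤ f (star x * x)

lemma exists_isQuasiState_matrix {n : ℕ} (M : Matrix (Fin n) (Fin n) ℂ) :
    ∃ g : Matrix (Fin n) (Fin n) ℂ →ₗ[ℂ] ℂ, IsQuasiState g ∧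
      (‖M‖ / 2) ^ 2 ≤ ‖g (star M * M)‖ := by
  let T := Matrix.toEuclideanCLM (n := Fin n) (𝕜 := ℂ)
  have hT : ∀ x, ‖T x‖ = ‖x‖ := fun x => Matrix.l2_opNorm_toEuclideanCLM x
  obtain ⟨ξ, hξ, hM⟩ : ∃ ξ : EuclideanSpace ℂ (Fin n), ‖ξ‖ ≤ 1 ∧ ‖M‖ / 2 ≤ ‖T M ξ‖ := by
    rcases eq_or_ne M 0 with rfl | hM
    · exact ⟨0, by simp, by simp⟩
    · obtain ⟨ξ, h1, h2⟩ := (T M).exists_lt_apply_of_lt_opNorm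
        (r := ‖M‖ / 2) (by rw [hT]; exact half_lt_self (norm_pos_iff.2 hM))
      exact ⟨ξ, h1.le, h2.le⟩
  let g : Matrix (Fin n) (Fin n) ℂ →ₗ[ℂ] ℂ :=
    innerₛₗ ℂ ξ ∘ₗ (ContinuousLinearMap.apply ℂ _ ξ).toLinearMap ∘ₗ
      T.toAlgEquiv.toLinearMap
  have hg : ∀ x, g (star x * x) = ((‖T x ξ‖ ^ 2 : ℝ) : ℂ) := fun x => by
    change ⟪ξ, T (star x * x) ξ⟫_ℂ = _
    rw [map_mul, map_star, ContinuousLinearMap.star_eq_adjoint, mul_apply_eq_comp,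
      ContinuousLinearMap.adjoint_inner_right, inner_self_eq_norm_sq_to_K]
    norm_cast
  refine ⟨g, ⟨fun x => ?_, fun x => ?_⟩, ?_⟩
  · calc ‖g x‖ ≤ ‖ξ‖ * ‖T x ξ‖ := norm_inner_le_norm ξ (T x ξ)
      _ ≤ 1 * (‖T x‖ * 1) := by
        gcongr
        exact (T x).le_opNorm_of_le hξ
      _ = ‖x‖ := by rw [hT, one_mul, mul_one]
  · rw [hg]
    exact Complex.zero_le_real.2 (sq_nonneg _)
  · rw [hg, Complex.norm_real, Real.norm_of_nonneg (sq_nonneg _)]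
    gcongr

namespace ProdModSum

variable {E : ℕ → Type u} [∀ k, NonUnitalCStarAlgebra (E k)]

lemma exists_ultralimit_functional {U : Ultrafilter ℕ} (hU : (U : Filter ℕ) ≤ atTop)
    {g : ∀ k, E k →ₗ[ℂ] ℂ} (hg : ∀ k x, ‖g k x‖ ≤ ‖x‖) :
    ∃ f : ProdModSum E →ₗ[ℂ] ℂ,
      ∀ x : lp E ∞, Tendsto (fun k => g k (x k)) U (𝓝 (f (mk E x))) := by
  have hlim : ∀ x : lp E ∞, ∃ z, Tendsto (fun k => g k (x k)) U (𝓝 z) := fun x => by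
    have hball : ∀ᶠ k in U, g k (x k) ∈ Metric.closedBall (0 : ℂ) ‖x‖ := .of_forall fun k =>
      mem_closedBall_zero_iff.2
        ((hg k _).trans (lp.norm_apply_le_norm ENNReal.top_ne_zero x k))
    obtain ⟨z, -, hz⟩ := (isCompact_closedBall (0 : ℂ) ‖x‖).ultrafilter_le_nhds
      (U.map fun k => g k (x k)) (le_principal_iff.2 hball)
    exact ⟨z, hz⟩
  choose lim hlim using hlim
  let L : lp E ∞ →ₗ[ℂ] ℂ :=
    { toFun := lim
      map_add' := fun x y => tendsto_nhds_unique (hlim (x + y))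
        (((hlim x).add (hlim y)).congr fun k => (map_add (g k) (x k) (y k)).symm)
      map_smul' := fun c x => tendsto_nhds_unique (hlim (c • x))
        (((hlim x).const_smul c).congr fun k => (map_smul (g k) c (x k)).symm) }
  have hL : sumIdeal E ≤ LinearMap.ker L := fun x hx =>
    tendsto_nhds_unique (hlim x)
      (squeeze_zero_norm (fun k => hg k (x k)) (hx.mono_left hU))
  exact ⟨(sumIdeal E).liftQ L hL, hlim⟩

lemma exists_isQuasiState (h : ∀ k (x : E k), ∃ g : E k →ₗ[ℂ] ℂ, IsQuasiState g ∧
      (‖x‖ / 2) ^ 2 ≤ ‖g (star x * x)‖) (z : ProdModSum E) :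
    ∃ f : ProdModSum E →ₗ[ℂ] ℂ, IsQuasiState f ∧ (‖z‖ / 4) ^ 2 ≤ ‖f (star z * z)‖ := by
  rcases eq_or_ne z 0 with rfl | hz
  · exact ⟨0, ⟨by simp, by simp⟩, by simp⟩
  obtain ⟨x, rfl⟩ := mk_surjective z
  choose g hg hgx using fun k => h k (x k)
  have hfreq := frequently_le_norm x (half_pos (norm_pos_iff.2 hz))
  have : NeBot (atTop ⊓ 𝓟 {k | ‖mk E x‖ - ‖mk E x‖ / 2 ≤ ‖x k‖}) :=
    frequently_mem_iff_neBot.1 hfreq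
  let U := Ultrafilter.of (atTop ⊓ 𝓟 {k | ‖mk E x‖ - ‖mk E x‖ / 2 ≤ ‖x k‖})
  have hU : (U : Filter ℕ) ≤ atTop := (Ultrafilter.of_le _).trans inf_le_left
  have hUx : ∀ᶠ k in U, ‖mk E x‖ - ‖mk E x‖ / 2 ≤ ‖x k‖ :=
    le_principal_iff.1 ((Ultrafilter.of_le _).trans inf_le_right)
  obtain ⟨f, hf⟩ := exists_ultralimit_functional hU fun k => (hg k).norm_le
  refine ⟨f, ⟨ind fun y => ?_, ind fun y => ?_⟩, ?_⟩
  · refine le_of_forall_pos_le_add fun ε hε => le_of_tendsto (hf y).norm ?_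
    exact ((eventually_norm_le y hε).filter_mono hU).mono fun k hk => ((hg k).norm_le _).trans hk
  · exact ge_of_tendsto' (hf (star y * y)) fun k => (hg k).nonneg (y k)
  · refine ge_of_tendsto (hf (star x * x)).norm (hUx.mono fun k hk => le_trans ?_ (hgx k))
    gcongr ?_ ^ 2
    linarith

end ProdModSum

variable {B : Type v} [NonUnitalCStarAlgebra B]

lemma exists_faithful_functional [TopologicalSpace.SeparableSpace B]
    (h : ∀ b : B, ∃ f : B →ₗ[ℂ] ℂ, IsQuasiState f ∧ (‖b‖ / 4) ^ 2 ≤ ‖f (star b * b)‖) :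
    ∃ f : B →ₗ[ℂ] ℂ, (∀ x, 0 ≤ f (star x * x)) ∧ ∀ x, f (star x * x) = 0 → x = 0 := by
  obtain ⟨d, hd⟩ := TopologicalSpace.exists_dense_seq B
  choose f hf hfd using fun a => h (d a)
  have hsum : ∀ x, Summable fun a => ((1 / 2 : ℂ) ^ a) * f a x := fun x => by
    refine Summable.of_norm_bounded (summable_geometric_two.mul_right ‖x‖) fun a => ?_
    rw [norm_mul, norm_pow, norm_div, norm_one, Complex.norm_two]
    gcongr
    exact (hf a).norm_le x
  have hpos : ∀ x a, 0 ≤ ((1 / 2 : ℂ) ^ a) * f a (star x * x) := fun x a =>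
    mul_nonneg (pow_nonneg (by norm_num [Complex.le_def]) a) ((hf a).nonneg x)
  refine ⟨{ toFun := fun x => ∑' a, ((1 / 2 : ℂ) ^ a) * f a x
            map_add' := fun x y => by
              rw [← (hsum x).tsum_add (hsum y)]
              exact tsum_congr fun a => by rw [map_add, mul_add]
            map_smul' := fun c x => by
              rw [RingHom.id_apply, smul_eq_mul, ← tsum_mul_left]
              exact tsum_congr fun a => by rw [map_smul, smul_eq_mul, mul_left_comm] },
    fun x => tsum_nonneg (hpos x), fun x (hx : ∑' a, _ = 0) => ?_⟩
  have hfx : ∀ a, f a (star x * x) = 0 := fun a => by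
    have h0 := (hasSum_zero_iff_of_nonneg (hpos x)).1 (hx ▸ (hsum (star x * x)).hasSum)
    exact (mul_eq_zero.1 (congrFun h0 a)).resolve_left (pow_ne_zero a (by norm_num))
  have hdist : ∀ y, (‖y‖ / 4) ^ 2 ≤ ‖star y * y - star x * x‖ := fun y => by
    refine hd.induction_on (p := fun y => (‖y‖ / 4) ^ 2 ≤ ‖star y * y - star x * x‖) y
      (isClosed_le (by fun_prop) (by fun_prop)) fun a => (hfd a).trans ?_
    rw [← sub_zero (f a _), ← hfx a, ← map_sub]
    exact (hf a).norm_le _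
  have hx4 : (‖x‖ / 4) ^ 2 = 0 :=
    le_antisymm (by simpa only [sub_self, norm_zero] using hdist x) (sq_nonneg _)
  simpa using hx4

lemma exists_faithful_hilbertRep_of_functional (f : B →ₗ[ℂ] ℂ)
    (hf : ∀ x, 0 ≤ f (star x * x)) (hf' : ∀ x, f (star x * x) = 0 → x = 0) :
    ∃ r : HilbertRep B, Function.Injective r.π := by
  let _ : PartialOrder B := CStarAlgebra.spectralOrder B
  have _ : StarOrderedRing B := CStarAlgebra.spectralOrderedRing B
  let F : B →ₚ[ℂ] ℂ := PositiveLinearMap.mk₀ f fun x hx => by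
    obtain ⟨y, rfl⟩ := CStarAlgebra.nonneg_iff_eq_star_mul_self.1 hx
    exact hf y
  refine ⟨⟨F.GNS, F.gnsNonUnitalStarAlgHom⟩, (injective_iff_map_eq_zero _).2
    fun b (hb : F.gnsNonUnitalStarAlgHom b = 0) => ?_⟩
  let ξ := F.leftMulMapPreGNS b (F.toPreGNS (star b))
  have hξ : ‖ξ‖ = 0 := by
    rw [← UniformSpace.Completion.norm_coe, ← F.gnsNonUnitalStarAlgHom_apply_coe, hb, zero_apply,
      norm_zero]
  have hb0 : F (star (b * star b) * (b * star b)) = 0 := by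
    have h := (F.preGNS_norm_sq ξ).symm
    rwa [hξ, Complex.ofReal_zero, zero_pow two_ne_zero] at h
  exact (CStarRing.mul_star_self_eq_zero_iff b).1 (hf' _ hb0)

lemma IsMF.exists_faithful_hilbertRep (h : IsMF B) :
    ∃ r : HilbertRep B, Function.Injective r.π := by
  obtain ⟨_, n, -, φ, hφ⟩ := h
  have hfun : ∀ b : B, ∃ f : B →ₗ[ℂ] ℂ, IsQuasiState f ∧ (‖b‖ / 4) ^ 2 ≤ ‖f (star b * b)‖ :=
    fun b => by
      obtain ⟨f, hf, hfb⟩ :=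
        ProdModSum.exists_isQuasiState (fun _ => exists_isQuasiState_matrix) (φ b)
      refine ⟨f ∘ₗ (φ : B →ₗ[ℂ] _), ⟨fun x => ?_, fun x => ?_⟩, ?_⟩
      · exact (hf.norm_le _).trans (NonUnitalStarAlgHom.norm_apply_le φ x)
      · refine (hf.nonneg (φ x)).trans_eq (congrArg f ?_)
        rw [← map_star, ← map_mul]
        rfl
      · rw [← map_star, ← map_mul, NonUnitalStarAlgHom.norm_map φ hφ] at hfb
        exact hfb
  obtain ⟨f, hf, hf'⟩ := exists_faithful_functional hfun
  exact exists_faithful_hilbertRep_of_functional f hf hf'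

end FaithfulRep

/-! ### Tensor products of representations and their compressions -/

section MatrixAction

open scoped InnerProductSpace

variable {K : Type*} [NormedAddCommGroup K] [InnerProductSpace ℂ K] [CompleteSpace K]
  {m : Type*} [Fintype m]

variable (K m) in
/-- The action of a matrix of operators on `K` on the Hilbert space direct sum of copies of `K`. -/
def matrixAction :
    CStarMatrix m m (K →L[ℂ] K) →⋆ₙₐ[ℂ]
      (PiLp 2 (fun _ : m => K) →L[ℂ] PiLp 2 (fun _ : m => K)) where
  toFun M := (PiLp.continuousLinearEquiv 2 ℂ (fun _ : m => K)).symm.toContinuousLinearMap ∘L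
    ContinuousLinearMap.pi fun s => ∑ t, M s t ∘L PiLp.proj 2 (fun _ : m => K) t
  map_zero' := by ext; simp
  map_add' M N := by ext; simp [Finset.sum_add_distrib]
  map_smul' c M := by ext; simp [Finset.smul_sum]
  map_mul' M N := by
    ext η s
    simp only [CStarMatrix.mul_apply, ContinuousLinearMap.comp_apply, mul_apply_eq_comp,
      ContinuousLinearEquiv.coe_coe, PiLp.coe_symm_continuousLinearEquiv,
      ContinuousLinearMap.pi_apply, sum_apply, PiLp.proj_apply, map_sum]
    exact Finset.sum_comm
  map_star' M := by
    rw [ContinuousLinearMap.star_eq_adjoint, ContinuousLinearMap.eq_adjoint_iff]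
    intro η ζ
    simp only [PiLp.inner_apply, ContinuousLinearMap.comp_apply, ContinuousLinearEquiv.coe_coe,
      PiLp.coe_symm_continuousLinearEquiv, ContinuousLinearMap.pi_apply,
      sum_apply, PiLp.proj_apply, sum_inner, inner_sum, CStarMatrix.star_apply,
      ContinuousLinearMap.star_eq_adjoint, ContinuousLinearMap.adjoint_inner_left]
    exact Finset.sum_comm

lemma matrixAction_apply (M : CStarMatrix m m (K →L[ℂ] K)) (η : PiLp 2 (fun _ : m => K)) (s : m) :
    matrixAction K m M η s = ∑ t, M s t (η t) := by
  simp [matrixAction]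

lemma matrixAction_injective : Function.Injective (matrixAction K m) := by
  classical
  have hentry : ∀ (M : CStarMatrix m m (K →L[ℂ] K)) s t κ,
      matrixAction K m M (WithLp.toLp 2 (Pi.single t κ)) s = M s t κ := fun M s t κ => by
    rw [matrixAction_apply, Finset.sum_eq_single t (fun u _ hu => by simp [hu]) (by simp)]
    simp only [Pi.single_eq_same]
  intro M N h
  ext s t κ
  rw [← hentry M, h, hentry N]

end MatrixAction

section TensorFamily

open scoped InnerProductSpace

variable {H K : Type*} [NormedAddCommGroup H] [InnerProductSpace ℂ H]
  [NormedAddCommGroup K] [InnerProductSpace ℂ K] {m : Type*} {e : m → H}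

/-- The map `ξ ⊗ κ ↦ (⟪eₛ, ξ⟫ κ)ₛ`, the adjoint of `tensorFamily e`. -/
def tensorCoords (e : m → H) : H ⊗[ℂ] K →ₗ[ℂ] PiLp 2 (fun _ : m => K) :=
  (WithLp.linearEquiv 2 ℂ (m → K)).symm.toLinearMap ∘ₗ LinearMap.pi fun s =>
    (TensorProduct.lid ℂ K).toLinearMap ∘ₗ LinearMap.rTensor K (innerₛₗ ℂ (e s))

lemma tensorCoords_tmul (ξ : H) (κ : K) (s : m) :
    tensorCoords e (ξ ⊗ₜ[ℂ] κ) s = ⟪e s, ξ⟫_ℂ • κ := by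
  simp [tensorCoords]

variable [Fintype m]

/-- The map `η ↦ ∑ₛ eₛ ⊗ ηₛ`, the adjoint of `tensorCoords e`. -/
def tensorFamily (e : m → H) : PiLp 2 (fun _ : m => K) →ₗ[ℂ] H ⊗[ℂ] K where
  toFun η := ∑ s, e s ⊗ₜ[ℂ] η s
  map_add' η ζ := by
    simp only [PiLp.add_apply, TensorProduct.tmul_add, Finset.sum_add_distrib]
  map_smul' c η := by
    simp only [PiLp.smul_apply, TensorProduct.tmul_smul, Finset.smul_sum, RingHom.id_apply]

lemma tensorFamily_apply (η : PiLp 2 (fun _ : m => K)) :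
    tensorFamily e η = ∑ s, e s ⊗ₜ[ℂ] η s := rfl

lemma inner_tensorFamily_left (η : PiLp 2 (fun _ : m => K)) (y : H ⊗[ℂ] K) :
    ⟪tensorFamily e η, y⟫_ℂ = ⟪η, tensorCoords e y⟫_ℂ := by
  induction y with
  | zero => rw [map_zero, inner_zero_right, inner_zero_right]
  | add x y hx hy => rw [inner_add_right, hx, hy, map_add, inner_add_right]
  | tmul ξ κ =>
    simp only [tensorFamily_apply, sum_inner, TensorProduct.inner_tmul, PiLp.inner_apply,
      tensorCoords_tmul, inner_smul_right]

lemma tensorFamily_tensorCoords_tmul (ξ : H) (κ : K) :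
    tensorFamily e (tensorCoords e (ξ ⊗ₜ[ℂ] κ)) = (∑ s, ⟪e s, ξ⟫_ℂ • e s) ⊗ₜ[ℂ] κ := by
  simp only [tensorFamily_apply, tensorCoords_tmul, TensorProduct.sum_tmul,
    TensorProduct.smul_tmul]

lemma tensorCoords_tensorFamily (he : Orthonormal ℂ e) (η : PiLp 2 (fun _ : m => K)) :
    tensorCoords e (tensorFamily e η) = η := by
  classical
  ext s
  simp [tensorCoords, tensorFamily, orthonormal_iff_ite.1 he, ite_smul]

lemma norm_tensorFamily (he : Orthonormal ℂ e) (η : PiLp 2 (fun _ : m => K)) :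
    ‖tensorFamily e η‖ = ‖η‖ := by
  rw [@norm_eq_sqrt_re_inner ℂ, inner_tensorFamily_left, tensorCoords_tensorFamily he,
    ← @norm_eq_sqrt_re_inner ℂ]

lemma norm_tensorCoords_le (he : Orthonormal ℂ e) (y : H ⊗[ℂ] K) : ‖tensorCoords e y‖ ≤ ‖y‖ := by
  rcases (norm_nonneg (tensorCoords e y)).eq_or_lt with h | h
  · exact h ▸ norm_nonneg y
  · refine le_of_mul_le_mul_left ?_ h
    calc ‖tensorCoords e y‖ * ‖tensorCoords e y‖
        = RCLike.re ⟪tensorFamily e (tensorCoords e y), y⟫_ℂ := by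
          rw [inner_tensorFamily_left, inner_self_eq_norm_mul_norm]
      _ ≤ ‖tensorFamily e (tensorCoords e y)‖ * ‖y‖ :=
          (Complex.re_le_norm _).trans (norm_inner_le_norm (tensorFamily e (tensorCoords e y)) y)
      _ = ‖tensorCoords e y‖ * ‖y‖ := by rw [norm_tensorFamily he]

lemma tendsto_tensorFamily_tensorCoords {ι : Type*} {l : Filter ι} {m : ι → Type*}
    [∀ i, Fintype (m i)] {e : ∀ i, m i → H}
    (hlim : ∀ ξ, Tendsto (fun i => ∑ s, ⟪e i s, ξ⟫_ℂ • e i s) l (𝓝 ξ)) (y : H ⊗[ℂ] K) :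
    Tendsto (fun i => tensorFamily (e i) (tensorCoords (e i) y)) l (𝓝 y) := by
  induction y with
  | zero => simpa only [map_zero] using tendsto_const_nhds
  | add x y hx hy => simpa only [map_add] using hx.add hy
  | tmul ξ κ =>
    simp only [tensorFamily_tensorCoords_tmul]
    exact (TensorProduct.continuous_tmul.tendsto (ξ, κ)).comp
      ((hlim ξ).prodMk_nhds tendsto_const_nhds)

end TensorFamily

section TensorRep

open scoped InnerProductSpace

variable {A B H K : Type*} [NonUnitalCStarAlgebra A] [NonUnitalCStarAlgebra B]
  [NormedAddCommGroup H] [InnerProductSpace ℂ H] [CompleteSpace H]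
  [NormedAddCommGroup K] [InnerProductSpace ℂ K] [CompleteSpace K]
  (σ : A →⋆ₙₐ[ℂ] (H →L[ℂ] H)) (ρ : B →⋆ₙₐ[ℂ] (K →L[ℂ] K))

/-- The tensor product `a ⊗ b ↦ σ a ⊗ ρ b` of two representations, acting on the algebraic tensor
product of the Hilbert spaces. -/
def tensorRep : A ⊗[ℂ] B →ₗ[ℂ] (H ⊗[ℂ] K →L[ℂ] H ⊗[ℂ] K) :=
  TensorProduct.lift (LinearMap.mk₂ ℂ TensorProduct.mapL TensorProduct.mapL_add_left
    TensorProduct.mapL_smul_left TensorProduct.mapL_add_right TensorProduct.mapL_smul_right) ∘ₗ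
    TensorProduct.map (σ : A →ₗ[ℂ] (H →L[ℂ] H)) (ρ : B →ₗ[ℂ] (K →L[ℂ] K))

lemma tensorRep_tmul (a : A) (b : B) :
    tensorRep σ ρ (a ⊗ₜ b) = TensorProduct.mapL (σ a) (ρ b) := rfl

lemma norm_tensorRep_tmul_le (a : A) (b : B) : ‖tensorRep σ ρ (a ⊗ₜ b)‖ ≤ ‖a‖ * ‖b‖ :=
  (TensorProduct.norm_mapL_le (σ a) (ρ b)).trans (mul_le_mul (NonUnitalStarAlgHom.norm_apply_le σ a)
    (NonUnitalStarAlgHom.norm_apply_le ρ b) (norm_nonneg _) (norm_nonneg _))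

/-- The compression `a ⊗ b ↦ (⟪eₛ, σ a eₜ⟫ b)ₛₜ` of `A ⊗ B` along a family `e` in the space of the
representation `σ` of `A`. -/
def repSlice {m : Type*} (e : m → H) : A ⊗[ℂ] B →ₗ[ℂ] CStarMatrix m m B :=
  CStarMatrix.ofMatrixₗ.toLinearMap ∘ₗ LinearMap.pi fun s => LinearMap.pi fun t =>
    (TensorProduct.lid ℂ B).toLinearMap ∘ₗ LinearMap.rTensor B
      (innerₛₗ ℂ (e s) ∘ₗ (ContinuousLinearMap.apply ℂ H (e t)).toLinearMap ∘ₗ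
        (σ : A →ₗ[ℂ] (H →L[ℂ] H)))

lemma repSlice_tmul {m : Type*} (e : m → H) (a : A) (b : B) (s t : m) :
    repSlice σ e (a ⊗ₜ b) s t = ⟪e s, σ a (e t)⟫_ℂ • b := rfl

variable {m : Type*} [Fintype m] {e : m → H}

lemma inner_tensorRep_tensorFamily (x : A ⊗[ℂ] B) (η ζ : PiLp 2 (fun _ : m => K)) :
    ⟪tensorFamily e η, tensorRep σ ρ x (tensorFamily e ζ)⟫_ℂ =
      ⟪η, matrixAction K m (CStarMatrix.mapₙₐ ρ (repSlice σ e x)) ζ⟫_ℂ := by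
  induction x with
  | zero => simp only [map_zero, zero_apply, inner_zero_right]
  | add x y hx hy => simp only [map_add, add_apply, inner_add_right, hx, hy]
  | tmul a b =>
    have hentry : ∀ s t, CStarMatrix.mapₙₐ ρ (repSlice σ e (a ⊗ₜ b)) s t =
        ⟪e s, σ a (e t)⟫_ℂ • ρ b := fun s t => map_smul ρ _ b
    simp only [tensorFamily_apply, map_sum, tensorRep_tmul, TensorProduct.mapL_tmul, sum_inner,
      inner_sum, TensorProduct.inner_tmul, PiLp.inner_apply, matrixAction_apply, hentry,
      smul_apply, inner_smul_right]
    exact Finset.sum_comm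

lemma norm_matrixAction_mapₙₐ [PartialOrder B] [StarOrderedRing B] {ρ : B →⋆ₙₐ[ℂ] (K →L[ℂ] K)}
    (hρ : Function.Injective ρ) (M : CStarMatrix m m B) :
    ‖matrixAction K m (CStarMatrix.mapₙₐ ρ M)‖ = ‖M‖ := by
  rw [NonUnitalStarAlgHom.norm_map (matrixAction K m) matrixAction_injective,
    norm_cstarMatrix_mapₙₐ ρ hρ]

lemma norm_repSlice_le [PartialOrder B] [StarOrderedRing B] {ρ : B →⋆ₙₐ[ℂ] (K →L[ℂ] K)}
    (hρ : Function.Injective ρ) (he : Orthonormal ℂ e) (x : A ⊗[ℂ] B) :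
    ‖repSlice σ e x‖ ≤ ‖tensorRep σ ρ x‖ := by
  rw [← norm_matrixAction_mapₙₐ hρ]
  refine ContinuousLinearMap.opNorm_le_of_re_inner_le (norm_nonneg (tensorRep σ ρ x))
    fun ζ η hζ hη => ?_
  rw [inner_re_symm, ← inner_tensorRep_tensorFamily]
  calc RCLike.re ⟪tensorFamily e η, tensorRep σ ρ x (tensorFamily e ζ)⟫_ℂ
      ≤ ‖tensorFamily e η‖ * ‖tensorRep σ ρ x (tensorFamily e ζ)‖ :=
        (Complex.re_le_norm _).trans
          (norm_inner_le_norm (tensorFamily e η) (tensorRep σ ρ x (tensorFamily e ζ)))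
    _ ≤ ‖tensorFamily e η‖ * (‖tensorRep σ ρ x‖ * ‖tensorFamily e ζ‖) := by
        gcongr
        exact (tensorRep σ ρ x).le_opNorm _
    _ = ‖tensorRep σ ρ x‖ := by
        rw [norm_tensorFamily he, norm_tensorFamily he, hζ, hη, mul_one, one_mul]

lemma norm_inner_tensorRep_compression_le [PartialOrder B] [StarOrderedRing B]
    (he : Orthonormal ℂ e) (x : A ⊗[ℂ] B) (y z : H ⊗[ℂ] K) :
    ‖⟪tensorFamily e (tensorCoords e z),
      tensorRep σ ρ x (tensorFamily e (tensorCoords e y))⟫_ℂ‖ ≤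
        ‖repSlice σ e x‖ * (‖z‖ * ‖y‖) := by
  let hom := (matrixAction K m).comp (CStarMatrix.mapₙₐ ρ)
  rw [inner_tensorRep_tensorFamily]
  calc ‖⟪tensorCoords e z, hom (repSlice σ e x) (tensorCoords e y)⟫_ℂ‖
      ≤ ‖tensorCoords e z‖ * (‖hom (repSlice σ e x)‖ * ‖tensorCoords e y‖) :=
        (norm_inner_le_norm _ _).trans
          (mul_le_mul_of_nonneg_left (ContinuousLinearMap.le_opNorm _ _) (norm_nonneg _))
    _ ≤ ‖z‖ * (‖repSlice σ e x‖ * ‖y‖) := by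
        gcongr
        · exact norm_tensorCoords_le he z
        · exact NonUnitalStarAlgHom.norm_apply_le hom _
        · exact norm_tensorCoords_le he y
    _ = ‖repSlice σ e x‖ * (‖z‖ * ‖y‖) := mul_left_comm _ _ _

lemma norm_tensorRep_le_of_frequently [PartialOrder B] [StarOrderedRing B] {ι : Type*}
    {l : Filter ι} {m : ι → Type*} [∀ i, Fintype (m i)] {e : ∀ i, m i → H}
    (he : ∀ i, Orthonormal ℂ (e i))
    (hlim : ∀ ξ, Tendsto (fun i => ∑ s, ⟪e i s, ξ⟫_ℂ • e i s) l (𝓝 ξ)) (x : A ⊗[ℂ] B) {r : ℝ}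
    (hr : ∃ᶠ i in l, ‖repSlice σ (e i) x‖ ≤ r) : ‖tensorRep σ ρ x‖ ≤ r := by
  have hinner : ∀ y z : H ⊗[ℂ] K, ‖⟪z, tensorRep σ ρ x y⟫_ℂ‖ ≤ r * (‖z‖ * ‖y‖) := fun y z => by
    have hconv := tendsto_tensorFamily_tensorCoords (K := K) hlim
    refine le_of_tendsto_of_frequently ((hconv z).inner
      (((tensorRep σ ρ x).continuous.tendsto y).comp (hconv y))).norm (hr.mono fun i hi => ?_)
    exact (norm_inner_tensorRep_compression_le σ ρ (he i) x y z).trans (by gcongr)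
  obtain ⟨i, hi⟩ := hr.exists
  refine ContinuousLinearMap.opNorm_le_of_re_inner_le ((norm_nonneg _).trans hi)
    fun y z hy hz => ?_
  rw [inner_re_symm]
  exact (Complex.re_le_norm _).trans ((hinner y z).trans_eq (by rw [hy, hz, mul_one, mul_one]))

end TensorRep

section FaithfulPair

open scoped InnerProductSpace

variable {A B H K H₀ K₀ : Type*} [NonUnitalCStarAlgebra A] [NonUnitalCStarAlgebra B]
  [NormedAddCommGroup H] [InnerProductSpace ℂ H]
  [NormedAddCommGroup K] [InnerProductSpace ℂ K] [CompleteSpace K]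
  [NormedAddCommGroup H₀] [InnerProductSpace ℂ H₀] [CompleteSpace H₀]
  [NormedAddCommGroup K₀] [InnerProductSpace ℂ K₀] [CompleteSpace K₀]

lemma exists_orthonormal_tendsto (H : Type*) [NormedAddCommGroup H] [InnerProductSpace ℂ H] :
    ∃ (m : Finset H → ℕ) (e : ∀ F, Fin (m F) → H), (∀ F, Orthonormal ℂ (e F)) ∧
      ∀ ξ, Tendsto (fun F => ∑ s, ⟪e F s, ξ⟫_ℂ • e F s) atTop (𝓝 ξ) := by
  let V : Finset H → Submodule ℂ H := fun F => Submodule.span ℂ (F : Set H)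
  let b := fun F => stdOrthonormalBasis ℂ (V F)
  refine ⟨fun F => Module.finrank ℂ (V F), fun F s => (b F s : H),
    fun F => (b F).orthonormal.comp_linearIsometry (V F).subtypeₗᵢ, fun ξ => ?_⟩
  refine tendsto_const_nhds.congr' ?_
  filter_upwards [eventually_ge_atTop {ξ}] with F hF
  have hξ : ξ ∈ V F := Submodule.subset_span (hF (Finset.mem_singleton_self ξ))
  simpa using (congrArg ((↑) : V F → H) ((b F).sum_repr' ⟨ξ, hξ⟩)).symm

variable [CompleteSpace H]

lemma norm_tensorRep_le_right (σ : A →⋆ₙₐ[ℂ] (H →L[ℂ] H)) (ρ : B →⋆ₙₐ[ℂ] (K →L[ℂ] K))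
    {ρ₀ : B →⋆ₙₐ[ℂ] (K₀ →L[ℂ] K₀)} (hρ₀ : Function.Injective ρ₀) (x : A ⊗[ℂ] B) :
    ‖tensorRep σ ρ x‖ ≤ ‖tensorRep σ ρ₀ x‖ := by
  let _ : PartialOrder B := CStarAlgebra.spectralOrder B
  have _ : StarOrderedRing B := CStarAlgebra.spectralOrderedRing B
  obtain ⟨m, e, he, hlim⟩ := exists_orthonormal_tendsto H
  exact norm_tensorRep_le_of_frequently σ ρ he hlim x
    (Eventually.of_forall fun F => norm_repSlice_le σ hρ₀ (he F) x).frequently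

lemma tensorRep_comm_apply (σ : A →⋆ₙₐ[ℂ] (H →L[ℂ] H)) (ρ : B →⋆ₙₐ[ℂ] (K →L[ℂ] K))
    (x : A ⊗[ℂ] B) (y : H ⊗[ℂ] K) :
    tensorRep ρ σ (TensorProduct.comm ℂ A B x) (TensorProduct.comm ℂ H K y) =
      TensorProduct.comm ℂ H K (tensorRep σ ρ x y) := by
  induction x with
  | zero => simp only [map_zero, zero_apply]
  | add x x' hx hx' => simp only [map_add, add_apply, hx, hx']
  | tmul a b =>
    simp only [TensorProduct.comm_tmul, tensorRep_tmul]
    induction y with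
    | zero => simp only [map_zero]
    | add y y' hy hy' => simp only [map_add, hy, hy']
    | tmul ξ κ => simp only [TensorProduct.comm_tmul, TensorProduct.mapL_tmul]

lemma norm_tensorRep_comm (σ : A →⋆ₙₐ[ℂ] (H →L[ℂ] H)) (ρ : B →⋆ₙₐ[ℂ] (K →L[ℂ] K))
    (x : A ⊗[ℂ] B) :
    ‖tensorRep ρ σ (TensorProduct.comm ℂ A B x)‖ = ‖tensorRep σ ρ x‖ := by
  refine le_antisymm
    (ContinuousLinearMap.opNorm_le_bound _ (norm_nonneg (tensorRep σ ρ x)) fun y => ?_)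
    (ContinuousLinearMap.opNorm_le_bound _ (norm_nonneg (tensorRep ρ σ _)) fun y => ?_)
  · obtain ⟨y, rfl⟩ := (TensorProduct.comm ℂ H K).surjective y
    rw [tensorRep_comm_apply, TensorProduct.norm_comm, TensorProduct.norm_comm]
    exact (tensorRep σ ρ x).le_opNorm y
  · rw [← TensorProduct.norm_comm, ← tensorRep_comm_apply, ← TensorProduct.norm_comm y]
    exact (tensorRep ρ σ _).le_opNorm _

lemma norm_tensorRep_le (σ : A →⋆ₙₐ[ℂ] (H →L[ℂ] H)) (ρ : B →⋆ₙₐ[ℂ] (K →L[ℂ] K))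
    {σ₀ : A →⋆ₙₐ[ℂ] (H₀ →L[ℂ] H₀)} (hσ₀ : Function.Injective σ₀)
    {ρ₀ : B →⋆ₙₐ[ℂ] (K₀ →L[ℂ] K₀)} (hρ₀ : Function.Injective ρ₀) (x : A ⊗[ℂ] B) :
    ‖tensorRep σ ρ x‖ ≤ ‖tensorRep σ₀ ρ₀ x‖ :=
  calc ‖tensorRep σ ρ x‖ ≤ ‖tensorRep σ ρ₀ x‖ := norm_tensorRep_le_right σ ρ hρ₀ x
    _ = ‖tensorRep ρ₀ σ (TensorProduct.comm ℂ A B x)‖ := (norm_tensorRep_comm σ ρ₀ x).symm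
    _ ≤ ‖tensorRep ρ₀ σ₀ (TensorProduct.comm ℂ A B x)‖ := norm_tensorRep_le_right ρ₀ σ hσ₀ _
    _ = ‖tensorRep σ₀ ρ₀ x‖ := norm_tensorRep_comm σ₀ ρ₀ x

end FaithfulPair

section Multiplicativity

open scoped InnerProductSpace

variable {A B H K : Type*} [NonUnitalCStarAlgebra A] [NonUnitalCStarAlgebra B]
  [NormedAddCommGroup H] [InnerProductSpace ℂ H] [CompleteSpace H]
  [NormedAddCommGroup K] [InnerProductSpace ℂ K] [CompleteSpace K]
  {m : Type*} {e : m → H} (σ : A →⋆ₙₐ[ℂ] (H →L[ℂ] H))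

lemma repSlice_star (x : A ⊗[ℂ] B) : repSlice σ e (star x) = star (repSlice σ e x) := by
  induction x with
  | zero => simp only [star_zero, map_zero]
  | add x y hx hy => simp only [star_add, map_add, hx, hy]
  | tmul a b =>
    ext s t
    rw [TensorProduct.star_tmul, CStarMatrix.star_apply, repSlice_tmul, repSlice_tmul, star_smul,
      map_star, ContinuousLinearMap.star_eq_adjoint, ContinuousLinearMap.adjoint_inner_right,
      RCLike.star_def, inner_conj_symm]

variable [Fintype m]

lemma repSlice_mul_sub {p : H →L[ℂ] H} (hpe : ∀ s, p (e s) = e s)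
    (hp : ∀ ξ, ∑ s, ⟪e s, ξ⟫_ℂ • e s = p ξ) (a a' : A) (b b' : B) :
    repSlice σ e ((a ⊗ₜ b) * (a' ⊗ₜ b')) - repSlice σ e (a ⊗ₜ b) * repSlice σ e (a' ⊗ₜ b') =
      repSlice (NonUnitalStarAlgHom.id ℂ (H →L[ℂ] H)) e
        ((σ a * (σ a' * p - p * σ a')) ⊗ₜ (b * b')) := by
  ext s t
  have hterm : ∀ u, repSlice σ e (a ⊗ₜ b) s u * repSlice σ e (a' ⊗ₜ b') u t =
      ⟪e s, σ a (⟪e u, σ a' (e t)⟫_ℂ • e u)⟫_ℂ • (b * b') := fun u => by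
    rw [repSlice_tmul, repSlice_tmul, smul_mul_smul_comm, map_smul, inner_smul_right, mul_comm]
  rw [Algebra.TensorProduct.tmul_mul_tmul, CStarMatrix.sub_apply, CStarMatrix.mul_apply,
    Finset.sum_congr rfl fun u _ => hterm u, ← Finset.sum_smul, ← inner_sum, ← map_sum, hp,
    repSlice_tmul, repSlice_tmul, ← sub_smul, ← inner_sub_right, map_mul, mul_apply_eq_comp,
    NonUnitalStarAlgHom.coe_id, id_eq, mul_apply_eq_comp, sub_apply, mul_apply_eq_comp,
    mul_apply_eq_comp, hpe, map_sub]

lemma tendsto_repSlice_mul [PartialOrder B] [StarOrderedRing B] {ρ : B →⋆ₙₐ[ℂ] (K →L[ℂ] K)}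
    (hρ : Function.Injective ρ) {ι : Type*} {l : Filter ι} {m : ι → Type*} [∀ i, Fintype (m i)]
    {e : ∀ i, m i → H} (he : ∀ i, Orthonormal ℂ (e i)) {p : ι → H →L[ℂ] H}
    (hpe : ∀ i s, p i (e i s) = e i s) (hp : ∀ i ξ, ∑ s, ⟪e i s, ξ⟫_ℂ • e i s = p i ξ)
    (hcomm : ∀ a, Tendsto (fun i => ‖σ a * p i - p i * σ a‖) l (𝓝 0)) (x y : A ⊗[ℂ] B) :
    Tendsto (fun i => ‖repSlice σ (e i) (x * y) - repSlice σ (e i) x * repSlice σ (e i) y‖)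
      l (𝓝 0) := by
  induction x with
  | zero => simpa only [zero_mul, map_zero, sub_zero, norm_zero] using tendsto_const_nhds
  | add x x' hx hx' =>
    refine squeeze_zero (fun i => norm_nonneg _) (fun i => ?_) (by simpa using hx.add hx')
    rw [add_mul, map_add, map_add, add_mul, add_sub_add_comm]
    exact norm_add_le _ _
  | tmul a b =>
    induction y with
    | zero => simpa only [mul_zero, map_zero, sub_zero, norm_zero] using tendsto_const_nhds
    | add y y' hy hy' =>
      refine squeeze_zero (fun i => norm_nonneg _) (fun i => ?_) (by simpa using hy.add hy')
      rw [mul_add, map_add, map_add, mul_add, add_sub_add_comm]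
      exact norm_add_le _ _
    | tmul a' b' =>
      refine squeeze_zero (fun i => norm_nonneg _) (fun i => ?_)
        (by simpa using ((hcomm a').const_mul ‖σ a‖).mul_const ‖b * b'‖)
      rw [repSlice_mul_sub σ (hpe i) (hp i)]
      refine (norm_repSlice_le _ hρ (he i) _).trans ((norm_tensorRep_tmul_le _ ρ _ _).trans ?_)
      gcongr
      exact norm_mul_le _ _

end Multiplicativity

/-! ### The minimal tensor product as a completion of the algebraic one -/

lemma hilbertTensor_ext {H K : Type*} [NormedAddCommGroup H] [InnerProductSpace ℂ H]
    [NormedAddCommGroup K] [InnerProductSpace ℂ K]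
    {S T : HilbertTensor H K →L[ℂ] HilbertTensor H K} (h : ∀ y : H ⊗[ℂ] K, S y = T y) : S = T :=
  DFunLike.coe_injective (UniformSpace.Completion.ext S.continuous T.continuous h)

section HilbertTensorRep

open scoped InnerProductSpace

variable {A B H K : Type*} [NonUnitalCStarAlgebra A] [NonUnitalCStarAlgebra B]
  [NormedAddCommGroup H] [InnerProductSpace ℂ H] [CompleteSpace H]
  [NormedAddCommGroup K] [InnerProductSpace ℂ K] [CompleteSpace K]
  (σ : A →⋆ₙₐ[ℂ] (H →L[ℂ] H)) (ρ : B →⋆ₙₐ[ℂ] (K →L[ℂ] K))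

lemma tensorRep_mul (x y : A ⊗[ℂ] B) :
    tensorRep σ ρ (x * y) = tensorRep σ ρ x * tensorRep σ ρ y := by
  induction x with
  | zero => rw [zero_mul, map_zero, zero_mul]
  | add x x' hx hx' => rw [add_mul, map_add, map_add, add_mul, hx, hx']
  | tmul a b =>
    induction y with
    | zero => rw [mul_zero, map_zero, mul_zero]
    | add y y' hy hy' => rw [mul_add, map_add, map_add, mul_add, hy, hy']
    | tmul a' b' =>
      rw [Algebra.TensorProduct.tmul_mul_tmul, tensorRep_tmul, tensorRep_tmul, tensorRep_tmul,
        map_mul, map_mul, TensorProduct.mapL_mul]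

lemma inner_tensorRep_star_left (x : A ⊗[ℂ] B) (y z : H ⊗[ℂ] K) :
    ⟪tensorRep σ ρ (star x) y, z⟫_ℂ = ⟪y, tensorRep σ ρ x z⟫_ℂ := by
  induction x with
  | zero => simp only [star_zero, map_zero, zero_apply, inner_zero_left, inner_zero_right]
  | add x x' hx hx' =>
    simp only [star_add, map_add, add_apply, inner_add_left, inner_add_right, hx, hx']
  | tmul a b =>
    rw [TensorProduct.star_tmul, tensorRep_tmul, tensorRep_tmul, map_star, map_star]
    induction y with
    | zero => rw [map_zero, inner_zero_left, inner_zero_left]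
    | add y y' hy hy' => rw [map_add, inner_add_left, inner_add_left, hy, hy']
    | tmul ξ κ =>
      induction z with
      | zero => rw [map_zero, inner_zero_right, inner_zero_right]
      | add z z' hz hz' => rw [map_add, inner_add_right, inner_add_right, hz, hz']
      | tmul ξ' κ' =>
        simp only [TensorProduct.mapL_tmul, TensorProduct.inner_tmul,
          ContinuousLinearMap.star_eq_adjoint, ContinuousLinearMap.adjoint_inner_left]

/-- The tensor product `a ⊗ b ↦ σ a ⊗ ρ b` of two representations, acting on the Hilbert space
tensor product. -/
def hilbertTensorRep : A ⊗[ℂ] B →⋆ₙₐ[ℂ] (HilbertTensor H K →L[ℂ] HilbertTensor H K) where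
  toFun x := (tensorRep σ ρ x).completion
  map_zero' := hilbertTensor_ext fun y => by
    simp only [ContinuousLinearMap.completion_apply_coe, map_zero, zero_apply,
      UniformSpace.Completion.coe_zero]
  map_add' x x' := hilbertTensor_ext fun y => by
    simp only [ContinuousLinearMap.completion_apply_coe, map_add, add_apply,
      UniformSpace.Completion.coe_add]
  map_smul' c x := hilbertTensor_ext fun y => by
    simp only [ContinuousLinearMap.completion_apply_coe, map_smul, smul_apply,
      UniformSpace.Completion.coe_smul, MonoidHom.id_apply]
  map_mul' x x' := hilbertTensor_ext fun y => by
    simp only [ContinuousLinearMap.completion_apply_coe, tensorRep_mul, mul_apply_eq_comp]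
  map_star' x := by
    rw [ContinuousLinearMap.star_eq_adjoint, ContinuousLinearMap.eq_adjoint_iff]
    intro y z
    induction y, z using UniformSpace.Completion.induction_on₂ with
    | hp => exact isClosed_eq (by fun_prop) (by fun_prop)
    | ih y z =>
      simp only [ContinuousLinearMap.completion_apply_coe, UniformSpace.Completion.inner_coe,
        inner_tensorRep_star_left]

lemma hilbertTensorRep_apply_coe (x : A ⊗[ℂ] B) (y : H ⊗[ℂ] K) :
    hilbertTensorRep σ ρ x y = tensorRep σ ρ x y :=
  ContinuousLinearMap.completion_apply_coe _ _

lemma norm_hilbertTensorRep (x : A ⊗[ℂ] B) : ‖hilbertTensorRep σ ρ x‖ = ‖tensorRep σ ρ x‖ := by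
  refine le_antisymm
    (ContinuousLinearMap.opNorm_le_bound _ (norm_nonneg (tensorRep σ ρ x)) fun y => ?_)
    (ContinuousLinearMap.opNorm_le_bound _ (norm_nonneg (hilbertTensorRep σ ρ x)) fun y => ?_)
  · induction y using UniformSpace.Completion.induction_on with
    | hp => exact isClosed_le (by fun_prop) (by fun_prop)
    | ih y =>
      simpa only [hilbertTensorRep_apply_coe, UniformSpace.Completion.norm_coe] using
        (tensorRep σ ρ x).le_opNorm y
  · simpa only [hilbertTensorRep_apply_coe, UniformSpace.Completion.norm_coe] using
      (hilbertTensorRep σ ρ x).le_opNorm y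

end HilbertTensorRep

section MinTensor

variable {A : Type u} [NonUnitalCStarAlgebra A] {B : Type v} [NonUnitalCStarAlgebra B]

lemma memℓp_hilbertTensorRep (x : A ⊗[ℂ] B) :
    Memℓp (E := fun r : HilbertRep A × HilbertRep B => RepOperators r)
      (fun r => hilbertTensorRep r.1.π r.2.π x) ∞ := by
  induction x with
  | zero =>
    simp only [map_zero]
    exact zero_memℓp
  | add x y hx hy =>
    simp only [map_add]
    exact hx.add hy
  | tmul a b => exact (elemTensor a b).2

variable (A B) in
/-- The canonical map from the algebraic tensor product, given on the pair `(σ, ρ)` of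
representations by `σ ⊗ ρ`. -/
def toRepProduct : A ⊗[ℂ] B →⋆ₙₐ[ℂ] RepProduct A B where
  toFun x := ⟨fun r => hilbertTensorRep r.1.π r.2.π x, memℓp_hilbertTensorRep x⟩
  map_zero' := lp.ext (funext fun r => map_zero (hilbertTensorRep r.1.π r.2.π))
  map_add' x y := lp.ext (funext fun r => map_add (hilbertTensorRep r.1.π r.2.π) x y)
  map_smul' c x := lp.ext (funext fun r => map_smul (hilbertTensorRep r.1.π r.2.π) c x)
  map_mul' x y := lp.ext (funext fun r => map_mul (hilbertTensorRep r.1.π r.2.π) x y)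
  map_star' x := lp.ext (funext fun r => map_star (hilbertTensorRep r.1.π r.2.π) x)

lemma toRepProduct_tmul (a : A) (b : B) : toRepProduct A B (a ⊗ₜ b) = elemTensor a b := rfl

lemma norm_toRepProduct_apply (x : A ⊗[ℂ] B) (r : HilbertRep A × HilbertRep B) :
    ‖toRepProduct A B x r‖ = ‖tensorRep r.1.π r.2.π x‖ :=
  norm_hilbertTensorRep r.1.π r.2.π x

lemma norm_toRepProduct (x : A ⊗[ℂ] B) {σ : HilbertRep A} (hσ : Function.Injective σ.π)
    {ρ : HilbertRep B} (hρ : Function.Injective ρ.π) :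
    ‖toRepProduct A B x‖ = ‖tensorRep σ.π ρ.π x‖ := by
  refine le_antisymm (lp.norm_le_of_forall_le (norm_nonneg (tensorRep σ.π ρ.π x)) fun r => ?_) ?_
  · rw [norm_toRepProduct_apply]
    exact norm_tensorRep_le r.1.π r.2.π hσ hρ x
  · rw [← norm_toRepProduct_apply x (σ, ρ)]
    exact lp.norm_apply_le_norm ENNReal.top_ne_zero _ _

lemma norm_elemTensor_le (a : A) (b : B) : ‖elemTensor a b‖ ≤ ‖a‖ * ‖b‖ :=
  lp.norm_le_of_forall_le (by positivity) fun r => by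
    rw [← toRepProduct_tmul, norm_toRepProduct_apply]
    exact norm_tensorRep_tmul_le r.1.π r.2.π a b

lemma adjoin_elemTensor_eq_range :
    NonUnitalStarAlgebra.adjoin ℂ {x : RepProduct A B | ∃ a b, x = elemTensor a b} =
      NonUnitalStarAlgHom.range (toRepProduct A B) := by
  refine le_antisymm (NonUnitalStarAlgebra.adjoin_le ?_) ?_
  · rintro _ ⟨a, b, rfl⟩
    exact ⟨a ⊗ₜ b, toRepProduct_tmul a b⟩
  · rintro _ ⟨x, rfl⟩
    induction x with
    | zero => exact map_zero (toRepProduct A B) ▸ zero_mem _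
    | add x y hx hy => exact map_add (toRepProduct A B) x y ▸ add_mem hx hy
    | tmul a b => exact NonUnitalStarAlgebra.subset_adjoin ℂ _ ⟨a, b, toRepProduct_tmul a b⟩

lemma minTensor_eq_topologicalClosure_range :
    MinTensor A B = (NonUnitalStarAlgHom.range (toRepProduct A B)).topologicalClosure := by
  rw [MinTensor, adjoin_elemTensor_eq_range]

variable (A B) in
/-- The canonical map from the algebraic tensor product to the minimal one. -/
def toMinTensor : A ⊗[ℂ] B →⋆ₙₐ[ℂ] MinTensor A B :=
  NonUnitalStarAlgHom.codRestrict (toRepProduct A B) (MinTensor A B) fun x =>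
    minTensor_eq_topologicalClosure_range (A := A) (B := B) ▸
      NonUnitalStarSubalgebra.le_topologicalClosure _ ⟨x, rfl⟩

lemma norm_toMinTensor (x : A ⊗[ℂ] B) {σ : HilbertRep A} (hσ : Function.Injective σ.π)
    {ρ : HilbertRep B} (hρ : Function.Injective ρ.π) :
    ‖toMinTensor A B x‖ = ‖tensorRep σ.π ρ.π x‖ :=
  norm_toRepProduct x hσ hρ

lemma denseRange_toMinTensor : DenseRange (toMinTensor A B) := by
  intro z
  rw [Topology.IsInducing.subtypeVal.closure_eq_preimage_closure_image]
  have hz : (z : RepProduct A B) ∈ closure (Set.range (toRepProduct A B)) :=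
    minTensor_eq_topologicalClosure_range.le z.2
  refine closure_mono ?_ hz
  rintro _ ⟨x, rfl⟩
  exact ⟨toMinTensor A B x, ⟨x, rfl⟩, rfl⟩

lemma separableSpace_minTensor [TopologicalSpace.SeparableSpace A]
    [TopologicalSpace.SeparableSpace B] : TopologicalSpace.SeparableSpace (MinTensor A B) := by
  let β : A →L[ℂ] B →L[ℂ] MinTensor A B :=
    ((TensorProduct.mk ℂ A B).compr₂ (toMinTensor A B : A ⊗[ℂ] B →ₗ[ℂ] MinTensor A B)).mkContinuous₂
      1 fun a b => (norm_elemTensor_le a b).trans_eq (by rw [one_mul])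
  have hβ : Continuous fun q : A × B => β q.1 q.2 := by fun_prop
  have hspan := ((TopologicalSpace.isSeparable_range hβ).span (R := ℂ)).closure
  rw [← TopologicalSpace.isSeparable_univ_iff]
  refine hspan.mono fun z _ => closure_mono ?_ (denseRange_toMinTensor z)
  rintro _ ⟨x, rfl⟩
  induction x with
  | zero => exact map_zero (toMinTensor A B) ▸ zero_mem _
  | add x y hx hy => exact map_add (toMinTensor A B) x y ▸ add_mem hx hy
  | tmul a b => exact Submodule.subset_span ⟨(a, b), rfl⟩

end MinTensor

/-! ### Compressing along the projections of a quasidiagonal representation -/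

section Quasidiagonal

open scoped InnerProductSpace

lemma exists_orthonormal_of_isStarProjection {H : Type*} [NormedAddCommGroup H]
    [InnerProductSpace ℂ H] [CompleteSpace H] {p : H →L[ℂ] H} (hp : IsStarProjection p)
    (hfin : FiniteDimensional ℂ p.range) :
    ∃ (m : ℕ) (e : Fin m → H), Orthonormal ℂ e ∧ (∀ s, p (e s) = e s) ∧
      ∀ ξ, ∑ s, ⟪e s, ξ⟫_ℂ • e s = p ξ := by
  let V : Submodule ℂ H := p.range
  let b := stdOrthonormalBasis ℂ V
  have hpe : ∀ s, p (b s : H) = b s := fun s => by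
    obtain ⟨ξ, hξ⟩ : ∃ ξ, p ξ = b s := (b s).2
    rw [← hξ, ← mul_apply_eq_comp, hp.isIdempotentElem.eq]
  have hsymm : ∀ ξ ζ, ⟪p ξ, ζ⟫_ℂ = ⟪ξ, p ζ⟫_ℂ := fun ξ ζ => by
    rw [← ContinuousLinearMap.adjoint_inner_right, ← ContinuousLinearMap.star_eq_adjoint,
      hp.isSelfAdjoint.star_eq]
  refine ⟨_, fun s => (b s : H), b.orthonormal.comp_linearIsometry V.subtypeₗᵢ, hpe, fun ξ => ?_⟩
  calc ∑ s, ⟪(b s : H), ξ⟫_ℂ • (b s : H)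
      = ∑ s, ⟪(b s : H), p ξ⟫_ℂ • (b s : H) :=
        Finset.sum_congr rfl fun s _ => by rw [← hsymm, hpe]
    _ = (∑ s, ⟪b s, (⟨p ξ, ξ, rfl⟩ : V)⟫_ℂ • b s : V) :=
        (AddSubmonoidClass.coe_finsetSum (fun s => ⟪b s, (⟨p ξ, ξ, rfl⟩ : V)⟫_ℂ • b s) _).symm
    _ = p ξ := congrArg ((↑) : V → H) (b.sum_repr' ⟨p ξ, ξ, rfl⟩)

variable {A : Type u} [NonUnitalCStarAlgebra A] {B : Type v} [NonUnitalCStarAlgebra B]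
  [PartialOrder B] [StarOrderedRing B]

theorem exists_embedding_minTensor {σ : HilbertRep A} (hσ : Function.Injective σ.π)
    (hqd : IsQuasidiagonalSet (Set.range σ.π)) {ρ : HilbertRep B} (hρ : Function.Injective ρ.π) :
    ∃ (m : ℕ → ℕ) (φ : MinTensor A B →⋆ₙₐ[ℂ]
      ProdModSum fun i => CStarMatrix (Fin (m i)) (Fin (m i)) B), Function.Injective φ := by
  obtain ⟨p, hproj, hfin, -, hlim, hcomm⟩ := hqd
  choose m e he hpe hp using fun i => exists_orthonormal_of_isStarProjection (hproj i) (hfin i)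
  have hlim' : ∀ ξ, Tendsto (fun i => ∑ s, ⟪e i s, ξ⟫_ℂ • e i s) atTop (𝓝 ξ) := fun ξ => by
    simpa only [hp] using hlim ξ
  refine ⟨m, exists_embedding_prodModSum_of_denseRange
    (ι := (toMinTensor A B : A ⊗[ℂ] B →ₙ+* MinTensor A B)) denseRange_toMinTensor
    (fun i => (repSlice σ.π (e i)).toAddMonoidHom)
    (tendsto_repSlice_mul σ.π hρ he hpe hp fun a => hcomm _ ⟨a, rfl⟩)
    (fun x => ⟨star x, map_star (toMinTensor A B) x, tendsto_const_nhds.congr fun i => ?_⟩)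
    (fun x => ⟨Complex.I • x, map_smul (toMinTensor A B) _ x,
      fun i => map_smul (repSlice σ.π (e i)) _ x⟩)
    (fun x ε hε => .of_forall fun i => ?_) (fun x ε hε hlt => ?_)⟩
  · exact (norm_eq_zero.2 (sub_eq_zero.2 (repSlice_star σ.π x))).symm
  · exact ((norm_repSlice_le σ.π hρ (he i) x).trans_eq (norm_toMinTensor x hσ hρ).symm).trans
      (le_add_of_nonneg_right hε.le)
  · have hle : ‖toMinTensor A B x‖ ≤ ‖toMinTensor A B x‖ - ε :=
      (norm_toMinTensor x hσ hρ).trans_le <| norm_tensorRep_le_of_frequently σ.π ρ.π he hlim' x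
        (hlt.mono fun i hi => (not_le.1 hi).le).frequently
    linarith

end Quasidiagonal

end

theorem proposition3p2 {A : Type u} [NonUnitalCStarAlgebra A] {B : Type v}
    [NonUnitalCStarAlgebra B] (hA : IsQuasidiagonal A) (hB : IsMF B) :
    IsMF (MinTensor A B) := by
  let _ : PartialOrder B := CStarAlgebra.spectralOrder B
  have _ : StarOrderedRing B := CStarAlgebra.spectralOrderedRing B
  have _ : TopologicalSpace.SeparableSpace A := hA.1
  have _ : TopologicalSpace.SeparableSpace B := hB.1
  have _ : TopologicalSpace.SeparableSpace (MinTensor A B) := separableSpace_minTensor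
  obtain ⟨-, H, _, _, _, π, hπ, hqd⟩ := hA
  obtain ⟨ρ, hρ⟩ := hB.exists_faithful_hilbertRep
  obtain ⟨m, φ, hφ⟩ := exists_embedding_minTensor (σ := ⟨H, π⟩) hπ hqd hρ
  exact (IsLocallyMF.of_prodModSum (fun i => hB.isLocallyMF_cstarMatrix (m i)) φ hφ).isMF
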